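/- Let $n\ge 2$ and let $\mathbb H^n$ be hyperbolic $n$-space with distance $d$ and hyperbolic volume $V$. A convex body in $\mathbb H^n$ is a compact, geodesically convex set with non-empty interior. A supporting hyperplane of a convex body $K$ is a hyperbolic hyperplane $H$ that meets $K$ and has $K$ in one of the two closed half-spaces that it bounds. The Lassak width of $K$ with respect to $H$ is $\max_{x\in K} d(x,H)$, and the minimal Lassak width $w(K)$ is the minimum of these widths over all supporting hyperplanes $H$ of $K$. Then for every $w>0$ and $n\ge 2$, $$\inf\{V(K) : K\subset\mathbb H^n \text{ a convex body with } w(K)\ge w\}=0.$$ Moreover, the following spindles witness this. There is a function $g:(0,\tfrac12)\to(1,\infty)$, independent of $n$, such that for every $n\geq 2$, every hyperbolic line $\ell\subset\mathbb H^n$ and every point $m\in\ell$, if $p_r,q_r$ denote the two points of $\ell$ with $d(p_r,m)=d(q_r,m)=g(r)$, and $K_r$ denotes the convex hull of $B(m,r)\cup\{p_r,q_r\}$, where $B(m,r)$ is the closed ball of center $m$ and radius $r$, then $K_r$ is a convex body and $w(K_r)\ge 1/r$ for all $r\in(0,\tfrac12)$; in particular, $\lim_{r\to0^+}w(K_r)=\infty$,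 while $\lim_{r\to 0^+}V(K_r)=0$. -/

import Mathlib

open MeasureTheory Set Filter Topology
open scoped ENNReal

noncomputable section

/-- Hyperbolic `n`-space in the Poincaré ball model: the open Euclidean unit ball of `ℝⁿ`, with the
Euclidean topology (which is also the topology of the hyperbolic distance `hypDist`). -/
abbrev HypSpace (n : ℕ) : Type :=
  Metric.ball (0 : EuclideanSpace ℝ (Fin n)) 1

/-- The hyperbolic distance of the Poincaré ball model. (The distance that `HypSpace n` inherits as a
subtype is the Euclidean one, and it is never used below.) -/
def hypDist {n : ℕ} (p q : HypSpace n) : ℝ :=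
  Real.arcosh (1 + 2 * ‖p.1 - q.1‖ ^ 2 / ((1 - ‖p.1‖ ^ 2) * (1 - ‖q.1‖ ^ 2)))

/-- The hyperbolic volume: the measure with density `(2 / (1 - ‖x‖²))ⁿ` with respect to the
Lebesgue measure on the unit ball. -/
def hypVolume (n : ℕ) : Measure (HypSpace n) :=
  (Measure.comap Subtype.val (volume : Measure (EuclideanSpace ℝ (Fin n)))).withDensity
    fun x => ENNReal.ofReal ((2 / (1 - ‖x.1‖ ^ 2)) ^ n)

/-- The closed hyperbolic ball of center `m` and radius `r`. -/
def hypClosedBall {n : ℕ} (m : HypSpace n) (r : ℝ) : Set (HypSpace n) :=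
  {x | hypDist m x ≤ r}

/-- The geodesic segment `[x, y]`: the points at which the triangle inequality is an equality. -/
def hypSegment {n : ℕ} (x y : HypSpace n) : Set (HypSpace n) :=
  {z | hypDist x z + hypDist z y = hypDist x y}

/-- Convexity: the geodesic segment between any two points of the set lies in the set. -/
def HypConvex {n : ℕ} (X : Set (HypSpace n)) : Prop :=
  ∀ x ∈ X, ∀ y ∈ X, hypSegment x y ⊆ X

/-- The convex hull: the smallest convex set containing `X`. -/
def hypConvexHull {n : ℕ} (X : Set (HypSpace n)) : Set (HypSpace n) :=
  ⋂₀ {C | HypConvex C ∧ X ⊆ C}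

/-- A convex body: a compact convex set with non-empty interior. -/
def IsHypConvexBody {n : ℕ} (K : Set (HypSpace n)) : Prop :=
  IsCompact K ∧ HypConvex K ∧ (interior K).Nonempty

/-- `H` is a hyperbolic hyperplane and `S` is one of the two closed half-spaces bounded by it.
A hyperplane is the trace on the open unit ball either of a linear hyperplane `u^⊥`, or of a sphere
with center `p` and radius `ρ` that is orthogonal to the unit sphere, that is, `‖p‖² = 1 + ρ²`.
(In the first case, both half-spaces are covered because `u` may be replaced by `-u`.) -/
def IsHypHalfSpace {n : ℕ} (S H : Set (HypSpace n)) : Prop :=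
  (∃ u : EuclideanSpace ℝ (Fin n), u ≠ 0 ∧
    H = {x | inner ℝ u x.1 = 0} ∧ S = {x | 0 ≤ inner ℝ u x.1}) ∨
  (∃ (p : EuclideanSpace ℝ (Fin n)) (ρ : ℝ), 0 < ρ ∧ ‖p‖ ^ 2 = 1 + ρ ^ 2 ∧
    H = {x | ‖x.1 - p‖ = ρ} ∧ (S = {x | ‖x.1 - p‖ ≤ ρ} ∨ S = {x | ρ ≤ ‖x.1 - p‖}))

/-- `H` is a supporting hyperplane of `K`: it meets `K`, and `K` lies in one of the two closed
half-spaces bounded by `H`. -/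
def IsHypSupportingHyperplane {n : ℕ} (K H : Set (HypSpace n)) : Prop :=
  (∃ S, IsHypHalfSpace S H ∧ K ⊆ S) ∧ (K ∩ H).Nonempty

/-- The hyperbolic distance of the point `x` from the set `H`. -/
def hypInfDist {n : ℕ} (x : HypSpace n) (H : Set (HypSpace n)) : ℝ :=
  sInf (hypDist x '' H)

/-- The Lassak width of `K` with respect to a supporting hyperplane `H`: the maximal distance of the
points of `K` from `H`. -/
def lassakWidthAt {n : ℕ} (K H : Set (HypSpace n)) : ℝ :=
  sSup ((fun x => hypInfDist x H) '' K)

/-- The minimal Lassak width `w(K)`: the smallest Lassak width of `K` with respect to its supporting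
hyperplanes. -/
def minLassakWidth {n : ℕ} (K : Set (HypSpace n)) : ℝ :=
  sInf (lassakWidthAt K '' {H | IsHypSupportingHyperplane K H})

/-- `γ` is a hyperbolic (geodesic) line, parametrized by arc length. -/
def IsHypLine {n : ℕ} (γ : ℝ → HypSpace n) : Prop :=
  ∀ s t : ℝ, hypDist (γ s) (γ t) = |s - t|

/-- The spindle on the line `γ` with midpoint `m = γ 0`: the convex hull of the ball `B(m, r)` and
the two points of the line at distance `a` from `m`. -/
def hypSpindle {n : ℕ} (γ : ℝ → HypSpace n) (r a : ℝ) : Set (HypSpace n) :=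
  hypConvexHull (hypClosedBall (γ 0) r ∪ {γ (-a), γ a})

end

/-!
In the hyperboloid model a half-space is `0 ≤ ⟪N, x⟫` with a unit spacelike normal vector `N`, and
`⟪N, x⟫` is the hyperbolic sine of the signed distance of `x` from the boundary hyperplane.

Width: if the spindle with center `m` lies in this half-space, then `sinh r ≤ ⟪N, m⟫` because the
ball of radius `r` lies in it. The two tips at distance `a` from `m` have sum `2 cosh a • m`, so one
of them satisfies `sinh r * cosh a ≤ ⟪N, tip⟫`. Hence the width is at least
`arsinh (sinh r * cosh a)`, which exceeds `1 / r` once `a = g(r)` is large.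

Volume: however large `a` is, the spindle stays in a convex neighborhood of the line whose thickness
at distance `t` from `m` is of order `r e^{-t}`. It is therefore covered by balls of radius
`5 r / (1 + r i)` whose centers are the points of the line at distance `log (1 + r i)` from `m`,
with `i = 0, 1, 2, …`. In dimension `n ≥ 2` their total volume is at most of order
`∑ (r / (1 + r i))² ≤ r² + r`.
-/

section PosSemidef

variable {V : Type*} [AddCommGroup V] [Module ℝ V] {B : LinearMap.BilinForm ℝ V}

theorem abs_apply_le_sqrt_mul_sqrt (hB : ∀ x, 0 ≤ B x x) (hs : LinearMap.IsSymm B) (x y : V) :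
    |B x y| ≤ √(B x x) * √(B y y) := by
  rw [← Real.sqrt_mul (hB x)]
  exact Real.abs_le_sqrt (B.apply_sq_le_of_symm hB hs x y)

theorem sqrt_apply_add_self_le (hB : ∀ x, 0 ≤ B x x) (hs : LinearMap.IsSymm B) (x y : V) :
    √(B (x + y) (x + y)) ≤ √(B x x) + √(B y y) := by
  have hxy : B x y ≤ √(B x x) * √(B y y) :=
    (le_abs_self _).trans (abs_apply_le_sqrt_mul_sqrt hB hs x y)
  have hyx : B y x = B x y := hs.eq y x
  rw [Real.sqrt_le_left (by positivity), add_sq, Real.sq_sqrt (hB x), Real.sq_sqrt (hB y)]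
  simp only [map_add, LinearMap.add_apply]
  linarith

theorem sqrt_apply_smul_self {c : ℝ} (hc : 0 ≤ c) (x : V) :
    √(B (c • x) (c • x)) = c * √(B x x) := by
  simp only [map_smul, LinearMap.smul_apply, smul_eq_mul]
  rw [← mul_assoc, Real.sqrt_mul (by positivity), Real.sqrt_mul_self hc]

end PosSemidef

/-- The Lorentz form `⟨x, y⟩ - s t` of the vectors `(s, x)` and `(t, y)` of `ℝ × E`. The hyperboloid
model is the sheet `0 < s` of the quadric on which it takes the value `-1`. -/
noncomputable def lorentzForm (E : Type*) [NormedAddCommGroup E] [InnerProductSpace ℝ E] :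
    LinearMap.BilinForm ℝ (ℝ × E) :=
  (innerₗ E).compl₁₂ (LinearMap.snd ℝ ℝ E) (LinearMap.snd ℝ ℝ E) -
    LinearMap.BilinForm.linMulLin (LinearMap.fst ℝ ℝ E) (LinearMap.fst ℝ ℝ E)

local notation "⟪" X "," Y "⟫" => lorentzForm _ X Y

section Lorentz

variable {E : Type*} [NormedAddCommGroup E] [InnerProductSpace ℝ E] {M U V : ℝ × E}

theorem lorentzForm_apply (X Y : ℝ × E) : ⟪X,Y⟫ = inner ℝ X.2 Y.2 - X.1 * Y.1 := rfl

theorem lorentzForm_self (X : ℝ × E) : ⟪X,X⟫ = ‖X.2‖ ^ 2 - X.1 ^ 2 := by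
  rw [lorentzForm_apply, real_inner_self_eq_norm_sq, sq X.1]

theorem lorentzForm_comm (X Y : ℝ × E) : ⟪X,Y⟫ = ⟪Y,X⟫ := by
  rw [lorentzForm_apply, lorentzForm_apply, real_inner_comm, mul_comm]

theorem continuous_lorentzForm (N : ℝ × E) : Continuous (lorentzForm E N) := by
  change Continuous fun X : ℝ × E => inner ℝ N.2 X.2 - N.1 * X.1
  fun_prop

theorem norm_snd_sq_le_of_lorentzForm_eq_zero (hM : ⟪M,M⟫ = -1) (hMV : ⟪M,V⟫ = 0) :
    ‖V.2‖ ^ 2 ≤ M.1 ^ 2 * ⟪V,V⟫ := by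
  have hcs := real_inner_mul_inner_self_le M.2 V.2
  rw [real_inner_self_eq_norm_sq, real_inner_self_eq_norm_sq] at hcs
  rw [lorentzForm_self] at hM ⊢
  rw [lorentzForm_apply, sub_eq_zero] at hMV
  rw [hMV, eq_add_of_sub_eq hM] at hcs
  linarith

theorem one_le_fst_sq (hM : ⟪M,M⟫ = -1) : 1 ≤ M.1 ^ 2 := by
  rw [lorentzForm_self] at hM
  linarith [sq_nonneg ‖M.2‖]

theorem lorentzForm_self_nonneg (hM : ⟪M,M⟫ = -1) (hMV : ⟪M,V⟫ = 0) : 0 ≤ ⟪V,V⟫ :=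
  nonneg_of_mul_nonneg_right
    ((sq_nonneg ‖V.2‖).trans (norm_snd_sq_le_of_lorentzForm_eq_zero hM hMV))
    (one_pos.trans_le (one_le_fst_sq hM))

theorem eq_zero_of_lorentzForm_self_eq_zero (hM : ⟪M,M⟫ = -1) (hMV : ⟪M,V⟫ = 0)
    (hV : ⟪V,V⟫ = 0) : V = 0 := by
  have h := norm_snd_sq_le_of_lorentzForm_eq_zero hM hMV
  have h₂ : V.2 = 0 := by simpa [hV] using h
  have h₁ : V.1 = 0 := by simpa [lorentzForm_apply, h₂] using hV
  exact Prod.ext h₁ h₂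

theorem fst_pos_of_lorentzForm_neg {X : ℝ × E} (hM : ⟪M,M⟫ = -1) (hM0 : 0 < M.1)
    (hX : ⟪X,X⟫ = -1) (hMX : ⟪M,X⟫ < 0) : 0 < X.1 := by
  by_contra! hX0
  rw [lorentzForm_self] at hM hX
  have hX₂ : ‖X.2‖ ≤ -X.1 := (sq_le_sq₀ (norm_nonneg _) (by linarith)).1 (by linarith)
  have hM₂ : ‖M.2‖ ≤ M.1 := (sq_le_sq₀ (norm_nonneg _) hM0.le).1 (by linarith)
  have hinner : -(‖M.2‖ * ‖X.2‖) ≤ inner ℝ M.2 X.2 :=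
    (abs_le.1 (abs_real_inner_le_norm M.2 X.2)).1
  have hmul : ‖M.2‖ * ‖X.2‖ ≤ M.1 * -X.1 := by gcongr
  rw [lorentzForm_apply] at hMX
  linarith

/-- The Lorentz form of the components of two vectors in the orthogonal complement of `M`, where
`⟪M,M⟫ = -1`. -/
noncomputable def lorentzPerp (M : ℝ × E) : LinearMap.BilinForm ℝ (ℝ × E) :=
  lorentzForm E + LinearMap.BilinForm.linMulLin (lorentzForm E M) (lorentzForm E M)

theorem lorentzPerp_apply (M X Y : ℝ × E) :
    lorentzPerp M X Y = ⟪X,Y⟫ + ⟪M,X⟫ * ⟪M,Y⟫ := rfl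

theorem lorentzPerp_isSymm (M : ℝ × E) : LinearMap.IsSymm (lorentzPerp M) :=
  ⟨fun X Y => by simp only [lorentzPerp_apply, lorentzForm_comm X Y, mul_comm, RingHom.id_apply]⟩

theorem lorentzPerp_self_nonneg (hM : ⟪M,M⟫ = -1) (X : ℝ × E) : 0 ≤ lorentzPerp M X X := by
  have hortho : ⟪M,X + ⟪M,X⟫ • M⟫ = 0 := by simp [hM]
  have hself : ⟪X + ⟪M,X⟫ • M,X + ⟪M,X⟫ • M⟫ = lorentzPerp M X X := by
    simp [lorentzPerp_apply, hM, lorentzForm_comm X M]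
  exact hself ▸ lorentzForm_self_nonneg hM hortho

/-- The Lorentz form of the components of two vectors in the orthogonal complement of the plane
spanned by `M` and `U`, where `⟪M,M⟫ = -1`, `⟪U,U⟫ = 1` and `⟪M,U⟫ = 0`. -/
noncomputable def lorentzPerpPlane (M U : ℝ × E) : LinearMap.BilinForm ℝ (ℝ × E) :=
  lorentzPerp M - LinearMap.BilinForm.linMulLin (lorentzForm E U) (lorentzForm E U)

theorem lorentzPerpPlane_apply (M U X Y : ℝ × E) :
    lorentzPerpPlane M U X Y = ⟪X,Y⟫ + ⟪M,X⟫ * ⟪M,Y⟫ - ⟪U,X⟫ * ⟪U,Y⟫ := rfl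

theorem lorentzPerpPlane_isSymm (M U : ℝ × E) : LinearMap.IsSymm (lorentzPerpPlane M U) :=
  ⟨fun X Y => by
    simp only [lorentzPerpPlane_apply, lorentzForm_comm X Y, mul_comm, RingHom.id_apply]⟩

theorem lorentzPerpPlane_self_nonneg (hM : ⟪M,M⟫ = -1) (hU : ⟪U,U⟫ = 1) (hMU : ⟪M,U⟫ = 0)
    (X : ℝ × E) : 0 ≤ lorentzPerpPlane M U X X := by
  have h := (lorentzPerp M).apply_sq_le_of_symm (lorentzPerp_self_nonneg hM)
    (lorentzPerp_isSymm M) U X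
  simp only [lorentzPerp_apply, hMU, hU, zero_mul, add_zero, one_mul] at h
  rw [lorentzPerpPlane_apply]
  linarith

end Lorentz

section Hyperboloid

variable {n : ℕ}

/-- The point of the hyperboloid model that corresponds to a point of the Poincaré ball model under
stereographic projection from `(-1, 0)`. -/
noncomputable def toHyperboloid (x : HypSpace n) : ℝ × EuclideanSpace ℝ (Fin n) :=
  ((1 + ‖x.1‖ ^ 2) / (1 - ‖x.1‖ ^ 2), (2 / (1 - ‖x.1‖ ^ 2)) • x.1)

theorem one_sub_norm_sq_pos (x : HypSpace n) : 0 < 1 - ‖x.1‖ ^ 2 := by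
  have h : ‖x.1‖ < 1 := mem_ball_zero_iff.1 x.2
  nlinarith [norm_nonneg x.1]

theorem toHyperboloid_fst_pos (x : HypSpace n) : 0 < (toHyperboloid x).1 :=
  div_pos (by positivity) (one_sub_norm_sq_pos x)

theorem continuous_toHyperboloid : Continuous (toHyperboloid (n := n)) := by
  have h : ∀ x : HypSpace n, 1 - ‖x.1‖ ^ 2 ≠ 0 := fun x => (one_sub_norm_sq_pos x).ne'
  unfold toHyperboloid
  fun_prop (disch := exact h _)

theorem lorentzForm_toHyperboloid (N : ℝ × EuclideanSpace ℝ (Fin n)) (x : HypSpace n) :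
    ⟪N,toHyperboloid x⟫ =
      (2 * inner ℝ N.2 x.1 - N.1 * (1 + ‖x.1‖ ^ 2)) / (1 - ‖x.1‖ ^ 2) := by
  have h := (one_sub_norm_sq_pos x).ne'
  simp only [lorentzForm_apply, toHyperboloid, inner_smul_right]
  field_simp

theorem neg_lorentzForm_toHyperboloid_toHyperboloid (x y : HypSpace n) :
    -⟪toHyperboloid x,toHyperboloid y⟫ =
      1 + 2 * ‖x.1 - y.1‖ ^ 2 / ((1 - ‖x.1‖ ^ 2) * (1 - ‖y.1‖ ^ 2)) := by
  have hx := (one_sub_norm_sq_pos x).ne'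
  have hy := (one_sub_norm_sq_pos y).ne'
  rw [lorentzForm_toHyperboloid, norm_sub_sq_real]
  simp only [toHyperboloid, inner_smul_left, conj_trivial]
  field_simp
  ring

theorem one_le_neg_lorentzForm_toHyperboloid (x y : HypSpace n) :
    1 ≤ -⟪toHyperboloid x,toHyperboloid y⟫ := by
  have hx := one_sub_norm_sq_pos x
  have hy := one_sub_norm_sq_pos y
  rw [neg_lorentzForm_toHyperboloid_toHyperboloid]
  exact le_add_of_nonneg_right (by positivity)

theorem hypDist_eq_arcosh (x y : HypSpace n) :
    hypDist x y = Real.arcosh (-⟪toHyperboloid x,toHyperboloid y⟫) := by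
  rw [neg_lorentzForm_toHyperboloid_toHyperboloid, hypDist]

theorem lorentzForm_eq_neg_cosh_hypDist (x y : HypSpace n) :
    ⟪toHyperboloid x,toHyperboloid y⟫ = -Real.cosh (hypDist x y) := by
  rw [hypDist_eq_arcosh, Real.cosh_arcosh (one_le_neg_lorentzForm_toHyperboloid x y), neg_neg]

theorem hypDist_nonneg (x y : HypSpace n) : 0 ≤ hypDist x y := by
  rw [hypDist_eq_arcosh]
  exact Real.arcosh_nonneg (one_le_neg_lorentzForm_toHyperboloid x y)

theorem hypDist_comm (x y : HypSpace n) : hypDist x y = hypDist y x := by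
  rw [hypDist_eq_arcosh, hypDist_eq_arcosh, lorentzForm_comm]

@[simp]
theorem hypDist_self (x : HypSpace n) : hypDist x x = 0 := by
  simp [hypDist]

@[simp]
theorem lorentzForm_toHyperboloid_self (x : HypSpace n) :
    ⟪toHyperboloid x,toHyperboloid x⟫ = -1 := by
  rw [lorentzForm_eq_neg_cosh_hypDist, hypDist_self, Real.cosh_zero]

theorem continuous_hypDist (x : HypSpace n) : Continuous (hypDist x) := by
  simp only [funext (hypDist_eq_arcosh x)]
  exact Real.continuousOn_arcosh.comp_continuous
    ((continuous_lorentzForm _).comp continuous_toHyperboloid).neg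
    (one_le_neg_lorentzForm_toHyperboloid x)

theorem hypDist_le_iff {x y : HypSpace n} {r : ℝ} (hr : 0 ≤ r) :
    hypDist x y ≤ r ↔ -⟪toHyperboloid x,toHyperboloid y⟫ ≤ Real.cosh r := by
  rw [lorentzForm_eq_neg_cosh_hypDist, neg_neg, Real.cosh_le_cosh,
    abs_of_nonneg (hypDist_nonneg x y), abs_of_nonneg hr]

theorem toHyperboloid_injective : Function.Injective (toHyperboloid (n := n)) := by
  intro x y h
  have hx := one_sub_norm_sq_pos x
  have hy := one_sub_norm_sq_pos y
  have hxy := neg_lorentzForm_toHyperboloid_toHyperboloid x y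
  rw [← h, lorentzForm_toHyperboloid_self, neg_neg, left_eq_add,
    div_eq_zero_iff, or_iff_left (mul_pos hx hy).ne'] at hxy
  have hnorm : ‖x.1 - y.1‖ = 0 := by simpa using hxy
  exact Subtype.ext (sub_eq_zero.1 (norm_eq_zero.1 hnorm))

theorem eq_of_hypDist_eq_zero {x y : HypSpace n} (h : hypDist x y = 0) : x = y := by
  have hxy : ⟪toHyperboloid x,toHyperboloid y⟫ = -1 := by
    rw [lorentzForm_eq_neg_cosh_hypDist, h, Real.cosh_zero]
  refine toHyperboloid_injective (sub_eq_zero.1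
    (eq_zero_of_lorentzForm_self_eq_zero (lorentzForm_toHyperboloid_self x) ?_ ?_)) <;>
  simp [hxy, lorentzForm_comm (toHyperboloid y)]

theorem exists_toHyperboloid_eq {X : ℝ × EuclideanSpace ℝ (Fin n)} (h0 : 0 < X.1)
    (hX : ⟪X,X⟫ = -1) : ∃ x : HypSpace n, toHyperboloid x = X := by
  obtain ⟨t, v⟩ := X
  replace h0 : 0 < t := h0
  have hv : ‖v‖ ^ 2 = t ^ 2 - 1 := by
    rw [lorentzForm_self] at hX
    linarith
  have hnorm : ‖(1 + t)⁻¹ • v‖ ^ 2 = (t - 1) / (1 + t) := by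
    rw [norm_smul, mul_pow, hv, Real.norm_eq_abs, sq_abs]
    field_simp
    ring
  have hden : 1 - (t - 1) / (1 + t) = 2 / (1 + t) := by
    field_simp
    ring
  have hlt : ‖(1 + t)⁻¹ • v‖ ^ 2 < 1 := by
    rw [hnorm, ← sub_pos, hden]
    positivity
  refine ⟨⟨(1 + t)⁻¹ • v, mem_ball_zero_iff.2 ((sq_lt_one_iff₀ (norm_nonneg _)).1 hlt)⟩, ?_⟩
  simp only [toHyperboloid, hnorm, hden, smul_smul]
  refine Prod.ext ?_ ?_
  · field_simp
    ring
  · rw [show 2 / (2 / (1 + t)) * (1 + t)⁻¹ = 1 by field_simp, one_smul]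

theorem exists_toHyperboloid_eq_cosh_smul_add_sinh_smul (m : HypSpace n)
    {V : ℝ × EuclideanSpace ℝ (Fin n)} (hmV : ⟪toHyperboloid m,V⟫ = 0) (hV : ⟪V,V⟫ = 1)
    (t : ℝ) : ∃ x, toHyperboloid x = Real.cosh t • toHyperboloid m + Real.sinh t • V := by
  have hself : ⟪Real.cosh t • toHyperboloid m + Real.sinh t • V,
      Real.cosh t • toHyperboloid m + Real.sinh t • V⟫ = -1 := by
    simp only [map_add, map_smul, LinearMap.add_apply, LinearMap.smul_apply, smul_eq_mul,
      lorentzForm_comm V, hmV, hV, lorentzForm_toHyperboloid_self]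
    linear_combination -Real.cosh_sq t
  have hneg : ⟪toHyperboloid m,Real.cosh t • toHyperboloid m + Real.sinh t • V⟫ < 0 := by
    simp [hmV, Real.cosh_pos]
  exact exists_toHyperboloid_eq (fst_pos_of_lorentzForm_neg (lorentzForm_toHyperboloid_self m)
    (toHyperboloid_fst_pos m) hself hneg) hself

theorem sinh_hypDist_nonneg (x y : HypSpace n) : 0 ≤ Real.sinh (hypDist x y) :=
  Real.sinh_nonneg_iff.2 (hypDist_nonneg x y)

theorem sqrt_lorentzPerp_toHyperboloid (z x : HypSpace n) :
    √(lorentzPerp (toHyperboloid z) (toHyperboloid x) (toHyperboloid x)) =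
      Real.sinh (hypDist z x) := by
  rw [← Real.sqrt_sq (sinh_hypDist_nonneg z x), Real.sinh_sq, lorentzPerp_apply,
    lorentzForm_toHyperboloid_self, lorentzForm_eq_neg_cosh_hypDist]
  ring_nf

theorem hypDist_triangle (x z y : HypSpace n) : hypDist x y ≤ hypDist x z + hypDist z y := by
  have h := (abs_le.1 (abs_apply_le_sqrt_mul_sqrt
    (lorentzPerp_self_nonneg (lorentzForm_toHyperboloid_self z)) (lorentzPerp_isSymm _)
    (toHyperboloid x) (toHyperboloid y))).1
  rw [sqrt_lorentzPerp_toHyperboloid, sqrt_lorentzPerp_toHyperboloid, lorentzPerp_apply,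
    lorentzForm_eq_neg_cosh_hypDist z, lorentzForm_eq_neg_cosh_hypDist z, hypDist_comm z x] at h
  rw [hypDist_le_iff (add_nonneg (hypDist_nonneg _ _) (hypDist_nonneg _ _)), Real.cosh_add]
  linarith

theorem abs_lorentzForm_le_sinh_hypDist {N : ℝ × EuclideanSpace ℝ (Fin n)} (hN : ⟪N,N⟫ = 1)
    {x y : HypSpace n} (hy : ⟪N,toHyperboloid y⟫ = 0) :
    |⟪N,toHyperboloid x⟫| ≤ Real.sinh (hypDist x y) := by
  have h := abs_apply_le_sqrt_mul_sqrt
    (lorentzPerp_self_nonneg (lorentzForm_toHyperboloid_self y)) (lorentzPerp_isSymm _)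
    N (toHyperboloid x)
  rw [sqrt_lorentzPerp_toHyperboloid] at h
  simpa [lorentzPerp_apply, lorentzForm_comm _ N, hy, hN, hypDist_comm y x] using h

theorem sinh_smul_toHyperboloid_of_mem_hypSegment {x y z : HypSpace n} (hz : z ∈ hypSegment x y) :
    Real.sinh (hypDist x y) • toHyperboloid z =
      Real.sinh (hypDist z y) • toHyperboloid x + Real.sinh (hypDist x z) • toHyperboloid y := by
  have hadd : hypDist x y = hypDist x z + hypDist z y := hz.symm
  have hsinh := congrArg Real.sinh hadd
  have hcosh := congrArg Real.cosh hadd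
  rw [Real.sinh_add] at hsinh
  rw [Real.cosh_add] at hcosh
  refine sub_eq_zero.1
    (eq_zero_of_lorentzForm_self_eq_zero (lorentzForm_toHyperboloid_self z) ?_ ?_)
  · simp only [map_add, map_sub, map_smul, smul_eq_mul, lorentzForm_eq_neg_cosh_hypDist,
      hypDist_comm z x, hypDist_self, Real.cosh_zero]
    linear_combination -hsinh
  · simp only [map_add, map_sub, map_smul, LinearMap.add_apply, LinearMap.sub_apply,
      LinearMap.smul_apply, smul_eq_mul, lorentzForm_eq_neg_cosh_hypDist,
      hypDist_comm z x, hypDist_comm y z, hypDist_comm y x, hypDist_self, Real.cosh_zero]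
    have hxz := Real.cosh_sq (hypDist x z)
    have hzy := Real.cosh_sq (hypDist z y)
    rw [hsinh, hcosh]
    linear_combination Real.sinh (hypDist x z) ^ 2 * hzy + Real.sinh (hypDist z y) ^ 2 * hxz

theorem sq_add_sq_add_two_mul_cosh_hypDist {x y z : HypSpace n} {a b : ℝ}
    (hz : toHyperboloid z = a • toHyperboloid x + b • toHyperboloid y) :
    a ^ 2 + b ^ 2 + 2 * a * b * Real.cosh (hypDist x y) = 1 := by
  have h := lorentzForm_toHyperboloid_self z
  simp only [hz, map_add, map_smul, LinearMap.add_apply, LinearMap.smul_apply, smul_eq_mul,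
    lorentzForm_eq_neg_cosh_hypDist, hypDist_comm y x, hypDist_self, Real.cosh_zero] at h
  linarith

theorem mem_hypSegment_of_toHyperboloid_eq {x y z : HypSpace n} {a b : ℝ} (ha : 0 ≤ a)
    (hb : 0 ≤ b) (hz : toHyperboloid z = a • toHyperboloid x + b • toHyperboloid y) :
    z ∈ hypSegment x y := by
  have hunit := sq_add_sq_add_two_mul_cosh_hypDist hz
  have hcosh₁ : Real.cosh (hypDist x z) = a + b * Real.cosh (hypDist x y) := by
    rw [← neg_inj, ← lorentzForm_eq_neg_cosh_hypDist, hz]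
    simp only [map_add, map_smul, smul_eq_mul, lorentzForm_toHyperboloid_self,
      lorentzForm_eq_neg_cosh_hypDist x y]
    ring
  have hcosh₂ : Real.cosh (hypDist z y) = a * Real.cosh (hypDist x y) + b := by
    rw [← neg_inj, ← lorentzForm_eq_neg_cosh_hypDist, hz]
    simp only [map_add, map_smul, LinearMap.add_apply, LinearMap.smul_apply, smul_eq_mul,
      lorentzForm_toHyperboloid_self, lorentzForm_eq_neg_cosh_hypDist x y]
    ring
  have hxy := Real.cosh_sq (hypDist x y)
  have hs := sinh_hypDist_nonneg x y
  have hsinh₁ : Real.sinh (hypDist x z) = b * Real.sinh (hypDist x y) := by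
    rw [← sq_eq_sq₀ (sinh_hypDist_nonneg _ _) (by positivity), Real.sinh_sq, hcosh₁]
    linear_combination hunit + b ^ 2 * hxy
  have hsinh₂ : Real.sinh (hypDist z y) = a * Real.sinh (hypDist x y) := by
    rw [← sq_eq_sq₀ (sinh_hypDist_nonneg _ _) (by positivity), Real.sinh_sq, hcosh₂]
    linear_combination hunit + a ^ 2 * hxy
  refine Real.cosh_strictMonoOn.injOn
    (add_nonneg (hypDist_nonneg x z) (hypDist_nonneg z y)) (hypDist_nonneg x y) ?_
  rw [Real.cosh_add, hcosh₁, hcosh₂, hsinh₁, hsinh₂]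
  linear_combination Real.cosh (hypDist x y) * hunit - a * b * hxy

theorem mem_hypSegment_iff_toHyperboloid {x y z : HypSpace n} :
    z ∈ hypSegment x y ↔ ∃ a b : ℝ, 0 ≤ a ∧ 0 ≤ b ∧
      toHyperboloid z = a • toHyperboloid x + b • toHyperboloid y := by
  refine ⟨fun hz => ?_, fun ⟨a, b, ha, hb, hz⟩ => mem_hypSegment_of_toHyperboloid_eq ha hb hz⟩
  rcases (hypDist_nonneg x y).eq_or_lt with hd | hd
  · have hadd : hypDist x z + hypDist z y = hypDist x y := hz
    have hxz : hypDist x z = 0 := by linarith [hypDist_nonneg x z, hypDist_nonneg z y]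
    exact ⟨1, 0, zero_le_one, le_rfl, by simp [eq_of_hypDist_eq_zero hxz]⟩
  · have hs : 0 < Real.sinh (hypDist x y) := Real.sinh_pos_iff.2 hd
    refine ⟨(Real.sinh (hypDist x y))⁻¹ * Real.sinh (hypDist z y),
      (Real.sinh (hypDist x y))⁻¹ * Real.sinh (hypDist x z),
      mul_nonneg (inv_nonneg.2 hs.le) (sinh_hypDist_nonneg z y),
      mul_nonneg (inv_nonneg.2 hs.le) (sinh_hypDist_nonneg x z), ?_⟩
    rw [mul_smul, mul_smul, ← smul_add, ← sinh_smul_toHyperboloid_of_mem_hypSegment hz,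
      inv_smul_smul₀ hs.ne']

end Hyperboloid

theorem isCompact_convexJoin {E : Type*} [AddCommGroup E] [Module ℝ E] [TopologicalSpace E]
    [ContinuousAdd E] [ContinuousSMul ℝ E] {s t : Set E} (hs : IsCompact s) (ht : IsCompact t) :
    IsCompact (convexJoin ℝ s t) := by
  have h : convexJoin ℝ s t =
      (fun p : ℝ × E × E => (1 - p.1) • p.2.1 + p.1 • p.2.2) '' (Icc 0 1 ×ˢ s ×ˢ t) := by
    ext z
    simp only [mem_convexJoin, segment_eq_image, mem_image, mem_prod, Prod.exists]
    grind
  rw [h]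
  exact (isCompact_Icc.prod (hs.prod ht)).image (by fun_prop)

section KleinModel

variable {n : ℕ}

/-- The point of the Klein model that corresponds to a point of the Poincaré ball model: the
central projection of the hyperboloid to the hyperplane `{1} × ℝⁿ`. It turns hyperbolic convexity
into Euclidean convexity. -/
noncomputable def toKlein (x : HypSpace n) : EuclideanSpace ℝ (Fin n) :=
  (toHyperboloid x).1⁻¹ • (toHyperboloid x).2

theorem continuous_toKlein : Continuous (toKlein (n := n)) :=
  (continuous_toHyperboloid.fst.inv₀ fun x => (toHyperboloid_fst_pos x).ne').smul
    continuous_toHyperboloid.snd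

theorem toHyperboloid_eq_smul (x : HypSpace n) :
    toHyperboloid x = (toHyperboloid x).1 • ((1 : ℝ), toKlein x) := by
  refine Prod.ext (by simp) ?_
  rw [Prod.smul_snd, toKlein, smul_inv_smul₀ (toHyperboloid_fst_pos x).ne']

theorem toHyperboloid_fst_sq_mul (x : HypSpace n) :
    (toHyperboloid x).1 ^ 2 * (1 - ‖toKlein x‖ ^ 2) = 1 := by
  have h := lorentzForm_toHyperboloid_self x
  rw [toHyperboloid_eq_smul x] at h
  simp only [map_smul, LinearMap.smul_apply, smul_eq_mul, lorentzForm_self] at h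
  linarith

theorem norm_toKlein_lt_one (x : HypSpace n) : ‖toKlein x‖ < 1 := by
  have h : 0 < (toHyperboloid x).1 ^ 2 * (1 - ‖toKlein x‖ ^ 2) :=
    (toHyperboloid_fst_sq_mul x).symm ▸ one_pos
  rw [← sq_lt_one_iff₀ (norm_nonneg _), ← sub_pos]
  exact pos_of_mul_pos_right h (sq_nonneg _)

theorem toKlein_injective : Function.Injective (toKlein (n := n)) := by
  intro x y h
  have hsq : (toHyperboloid x).1 ^ 2 = (toHyperboloid y).1 ^ 2 := by
    have hy := toHyperboloid_fst_sq_mul y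
    refine mul_right_cancel₀ (right_ne_zero_of_mul_eq_one hy) (Eq.trans ?_ hy.symm)
    rw [← h, toHyperboloid_fst_sq_mul]
  rw [sq_eq_sq₀ (toHyperboloid_fst_pos x).le (toHyperboloid_fst_pos y).le] at hsq
  apply toHyperboloid_injective
  rw [toHyperboloid_eq_smul x, toHyperboloid_eq_smul y, h, hsq]

theorem exists_toKlein_eq {k : EuclideanSpace ℝ (Fin n)} (hk : ‖k‖ < 1) :
    ∃ x : HypSpace n, toKlein x = k := by
  have hpos : 0 < 1 - ‖k‖ ^ 2 := sub_pos.2 ((sq_lt_one_iff₀ (norm_nonneg _)).2 hk)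
  have hc : 0 < (√(1 - ‖k‖ ^ 2))⁻¹ := by positivity
  have hself : ⟪(√(1 - ‖k‖ ^ 2))⁻¹ • ((1 : ℝ), k),(√(1 - ‖k‖ ^ 2))⁻¹ • ((1 : ℝ), k)⟫ = -1 := by
    simp only [map_smul, LinearMap.smul_apply, smul_eq_mul, lorentzForm_self]
    rw [← mul_assoc, ← sq, inv_pow, Real.sq_sqrt hpos.le]
    field_simp
    ring
  obtain ⟨x, hx⟩ := exists_toHyperboloid_eq (by simpa using hpos) hself
  exact ⟨x, by rw [toKlein, hx, Prod.smul_fst, Prod.smul_snd, smul_eq_mul, mul_one,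
    inv_smul_smul₀ hc.ne']⟩

theorem mem_hypSegment_iff_toKlein {x y z : HypSpace n} :
    z ∈ hypSegment x y ↔ toKlein z ∈ segment ℝ (toKlein x) (toKlein y) := by
  have hx := toHyperboloid_fst_pos x
  have hy := toHyperboloid_fst_pos y
  have hz := toHyperboloid_fst_pos z
  constructor
  · intro h
    obtain ⟨a, b, ha, hb, h⟩ := mem_hypSegment_iff_toHyperboloid.1 h
    have h₁ : (toHyperboloid z).1 = a * (toHyperboloid x).1 + b * (toHyperboloid y).1 := by
      simp [h]
    have h₂ : (toHyperboloid z).2 = a • (toHyperboloid x).2 + b • (toHyperboloid y).2 := by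
      simp [h]
    refine ⟨a * (toHyperboloid x).1 / (toHyperboloid z).1,
      b * (toHyperboloid y).1 / (toHyperboloid z).1, by positivity, by positivity, ?_, ?_⟩
    · rw [← add_div, ← h₁, div_self hz.ne']
    · simp only [toKlein, h₂, smul_add, smul_smul]
      congr 2 <;> field_simp
  · rintro ⟨a, b, ha, hb, hab, h⟩
    refine mem_hypSegment_of_toHyperboloid_eq
      (a := (toHyperboloid z).1 * a / (toHyperboloid x).1)
      (b := (toHyperboloid z).1 * b / (toHyperboloid y).1) (by positivity) (by positivity) ?_
    refine Prod.ext ?_ ?_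
    · simp only [Prod.smul_fst, Prod.fst_add, smul_eq_mul]
      field_simp
      linarith
    · rw [toHyperboloid_eq_smul z, ← h]
      simp only [toKlein, Prod.smul_mk, Prod.smul_snd, Prod.snd_add, smul_add, smul_smul,
        smul_eq_mul, mul_one]
      congr 2 <;> field_simp

theorem HypConvex.convex_image_toKlein {C : Set (HypSpace n)} (hC : HypConvex C) :
    Convex ℝ (toKlein '' C) := by
  rw [convex_iff_segment_subset]
  rintro _ ⟨x, hx, rfl⟩ _ ⟨y, hy, rfl⟩ k hk
  have hk1 : ‖k‖ < 1 := mem_ball_zero_iff.1 ((convex_ball 0 1).segment_subset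
    (mem_ball_zero_iff.2 (norm_toKlein_lt_one x)) (mem_ball_zero_iff.2 (norm_toKlein_lt_one y)) hk)
  obtain ⟨z, rfl⟩ := exists_toKlein_eq hk1
  exact mem_image_of_mem _ (hC x hx y hy (mem_hypSegment_iff_toKlein.2 hk))

theorem hypConvex_preimage_toKlein {D : Set (EuclideanSpace ℝ (Fin n))} (hD : Convex ℝ D) :
    HypConvex (toKlein ⁻¹' D) :=
  fun _ hx _ hy _ hz => hD.segment_subset hx hy (mem_hypSegment_iff_toKlein.1 hz)

theorem hypConvexHull_eq_preimage_toKlein (G : Set (HypSpace n)) :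
    hypConvexHull G = toKlein ⁻¹' convexHull ℝ (toKlein '' G) := by
  apply Subset.antisymm
  · exact sInter_subset_of_mem ⟨hypConvex_preimage_toKlein (convex_convexHull ℝ _),
      fun x hx => subset_convexHull ℝ _ (mem_image_of_mem _ hx)⟩
  · rintro x hx C ⟨hC, hGC⟩
    obtain ⟨y, hy, hyx⟩ := convexHull_min (image_mono hGC) hC.convex_image_toKlein hx
    rwa [← toKlein_injective hyx]

theorem hypConvex_hypConvexHull (G : Set (HypSpace n)) : HypConvex (hypConvexHull G) := by
  rw [hypConvexHull_eq_preimage_toKlein]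
  exact hypConvex_preimage_toKlein (convex_convexHull ℝ _)

theorem subset_hypConvexHull (G : Set (HypSpace n)) : G ⊆ hypConvexHull G :=
  subset_sInter fun _ hC => hC.2

theorem hypConvexHull_subset {G C : Set (HypSpace n)} (hC : HypConvex C) (h : G ⊆ C) :
    hypConvexHull G ⊆ C :=
  sInter_subset_of_mem ⟨hC, h⟩

end KleinModel

section ConvexBody

variable {n : ℕ}

theorem isClosed_hypClosedBall (m : HypSpace n) (r : ℝ) : IsClosed (hypClosedBall m r) :=
  isClosed_le (continuous_hypDist m) continuous_const

theorem isCompact_of_isClosed_of_norm_le {C : Set (HypSpace n)} (hC : IsClosed C) {ρ : ℝ}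
    (hρ : ρ < 1) (h : ∀ x ∈ C, ‖x.1‖ ≤ ρ) : IsCompact C := by
  have hsub : Metric.closedBall (0 : EuclideanSpace ℝ (Fin n)) ρ ⊆
      range (Subtype.val : HypSpace n → EuclideanSpace ℝ (Fin n)) := by
    rw [Subtype.range_val]
    exact Metric.closedBall_subset_ball hρ
  refine ((Topology.IsInducing.subtypeVal.isCompact_preimage_iff hsub).2
    (isCompact_closedBall 0 ρ)).of_isClosed_subset hC fun x hx => ?_
  exact mem_closedBall_zero_iff.2 (h x hx)

theorem isCompact_hypClosedBall (m : HypSpace n) (r : ℝ) : IsCompact (hypClosedBall m r) := by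
  let o : HypSpace n := ⟨0, Metric.mem_ball_self one_pos⟩
  set c := Real.cosh (hypDist o m + r)
  have : 0 < c := Real.cosh_pos _
  have hlt : (c - 1) / (c + 1) < 1 := by
    rw [div_lt_one (by positivity)]
    linarith
  refine isCompact_of_isClosed_of_norm_le (isClosed_hypClosedBall m r)
    (ρ := √((c - 1) / (c + 1))) (by rwa [Real.sqrt_lt' one_pos, one_pow]) fun x hx => ?_
  have hox : hypDist o x ≤ hypDist o m + r :=
    (hypDist_triangle o m x).trans (add_le_add_right hx _)
  rw [hypDist_le_iff ((hypDist_nonneg o x).trans hox),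
    neg_lorentzForm_toHyperboloid_toHyperboloid] at hox
  have hx1 := one_sub_norm_sq_pos x
  have hle : 1 + 2 * ‖x.1‖ ^ 2 / (1 - ‖x.1‖ ^ 2) ≤ c := by simpa [o] using hox
  rw [← le_sub_iff_add_le', div_le_iff₀ hx1] at hle
  refine Real.le_sqrt_of_sq_le ?_
  rw [le_div_iff₀ (by positivity)]
  linarith

theorem add_le_one_of_toHyperboloid_eq {x y z : HypSpace n} {a b : ℝ} (ha : 0 ≤ a) (hb : 0 ≤ b)
    (hz : toHyperboloid z = a • toHyperboloid x + b • toHyperboloid y) : a + b ≤ 1 := by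
  rw [← sq_le_one_iff₀ (by positivity), ← sq_add_sq_add_two_mul_cosh_hypDist hz]
  nlinarith [mul_le_mul_of_nonneg_left (Real.one_le_cosh (hypDist x y)) (mul_nonneg ha hb)]

theorem hypConvex_hypClosedBall (m : HypSpace n) {r : ℝ} (hr : 0 ≤ r) :
    HypConvex (hypClosedBall m r) := by
  intro x hx y hy z hz
  obtain ⟨a, b, ha, hb, hz⟩ := mem_hypSegment_iff_toHyperboloid.1 hz
  refine (hypDist_le_iff hr).2 ?_
  calc -⟪toHyperboloid m,toHyperboloid z⟫
      = a * -⟪toHyperboloid m,toHyperboloid x⟫ + b * -⟪toHyperboloid m,toHyperboloid y⟫ := by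
        simp only [hz, map_add, map_smul, smul_eq_mul]
        ring
    _ ≤ a * Real.cosh r + b * Real.cosh r := by
        gcongr
        · exact (hypDist_le_iff hr).1 hx
        · exact (hypDist_le_iff hr).1 hy
    _ = (a + b) * Real.cosh r := (add_mul _ _ _).symm
    _ ≤ Real.cosh r := mul_le_of_le_one_left (Real.cosh_pos r).le
        (add_le_one_of_toHyperboloid_eq ha hb hz)

theorem isCompact_hypConvexHull {G : Set (HypSpace n)} (hG : IsCompact G)
    (hG' : IsCompact (convexHull ℝ (toKlein '' G))) : IsCompact (hypConvexHull G) := by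
  rcases G.eq_empty_or_nonempty with rfl | ⟨m, hm⟩
  · simp [hypConvexHull_eq_preimage_toKlein]
  obtain ⟨R, hR⟩ := (hG.image (continuous_hypDist m)).bddAbove
  have hball : G ⊆ hypClosedBall m R := fun x hx => hR (mem_image_of_mem _ hx)
  have hR0 : 0 ≤ R := (hypDist_nonneg m m).trans (hball hm)
  refine (isCompact_hypClosedBall m R).of_isClosed_subset ?_
    (hypConvexHull_subset (hypConvex_hypClosedBall m hR0) hball)
  rw [hypConvexHull_eq_preimage_toKlein]
  exact hG'.isClosed.preimage continuous_toKlein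

theorem isCompact_hypConvexHull_union {C F : Set (HypSpace n)} (hC : IsCompact C)
    (hC' : HypConvex C) (hC₀ : C.Nonempty) (hF : F.Finite) (hF₀ : F.Nonempty) :
    IsCompact (hypConvexHull (C ∪ F)) := by
  refine isCompact_hypConvexHull (hC.union hF.isCompact) ?_
  rw [image_union, convexHull_union (hC₀.image _) (hF₀.image _),
    hC'.convex_image_toKlein.convexHull_eq]
  exact isCompact_convexJoin (hC.image continuous_toKlein) ((hF.image _).isCompact_convexHull _)

theorem isHypConvexBody_hypSpindle (γ : ℝ → HypSpace n) {r : ℝ} (hr : 0 < r) (a : ℝ) :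
    IsHypConvexBody (hypSpindle γ r a) := by
  have hball : (hypClosedBall (γ 0) r).Nonempty := ⟨γ 0, by simpa [hypClosedBall] using hr.le⟩
  refine ⟨isCompact_hypConvexHull_union (isCompact_hypClosedBall _ r)
    (hypConvex_hypClosedBall _ hr.le) hball (toFinite _) (insert_nonempty _ _),
    hypConvex_hypConvexHull _, γ 0, ?_⟩
  exact mem_interior.2 ⟨{x | hypDist (γ 0) x < r},
    fun x (hx : hypDist (γ 0) x < r) => subset_hypConvexHull _ (Or.inl hx.le),
    isOpen_lt (continuous_hypDist _) continuous_const, by simpa using hr⟩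

end ConvexBody

section HalfSpaces

variable {n : ℕ} {N : ℝ × EuclideanSpace ℝ (Fin n)}

/-- The hyperplane of the points that are Lorentz orthogonal to the normal vector `N`, in the
Poincaré ball model. -/
def hypHyperplane (N : ℝ × EuclideanSpace ℝ (Fin n)) : Set (HypSpace n) :=
  {x | ⟪N,toHyperboloid x⟫ = 0}

/-- The closed half-space bounded by `hypHyperplane N` with inner normal vector `N`. -/
def hypHalfSpace (N : ℝ × EuclideanSpace ℝ (Fin n)) : Set (HypSpace n) :=
  {x | 0 ≤ ⟪N,toHyperboloid x⟫}

theorem mem_hypHyperplane {x : HypSpace n} : x ∈ hypHyperplane N ↔ ⟪N,toHyperboloid x⟫ = 0 :=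
  Iff.rfl

theorem mem_hypHalfSpace {x : HypSpace n} : x ∈ hypHalfSpace N ↔ 0 ≤ ⟪N,toHyperboloid x⟫ :=
  Iff.rfl

theorem hypHyperplane_neg (N : ℝ × EuclideanSpace ℝ (Fin n)) :
    hypHyperplane (-N) = hypHyperplane N := by
  ext x
  simp [mem_hypHyperplane]

theorem hypHyperplane_smul {c : ℝ} (hc : c ≠ 0) (N : ℝ × EuclideanSpace ℝ (Fin n)) :
    hypHyperplane (c • N) = hypHyperplane N := by
  ext x
  simp [mem_hypHyperplane, hc]

theorem hypHalfSpace_smul {c : ℝ} (hc : 0 < c) (N : ℝ × EuclideanSpace ℝ (Fin n)) :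
    hypHalfSpace (c • N) = hypHalfSpace N := by
  ext x
  simp [mem_hypHalfSpace, hc]

theorem hypHyperplane_zero_left (u : EuclideanSpace ℝ (Fin n)) :
    hypHyperplane (0, u) = {x | inner ℝ u x.1 = 0} := by
  ext x
  simp [mem_hypHyperplane, lorentzForm_toHyperboloid, (one_sub_norm_sq_pos x).ne']

theorem hypHalfSpace_zero_left (u : EuclideanSpace ℝ (Fin n)) :
    hypHalfSpace (0, u) = {x | 0 ≤ inner ℝ u x.1} := by
  ext x
  simp [mem_hypHalfSpace, lorentzForm_toHyperboloid, le_div_iff₀ (one_sub_norm_sq_pos x)]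

theorem sq_sub_norm_sub_sq {p : EuclideanSpace ℝ (Fin n)} {ρ : ℝ} (hp : ‖p‖ ^ 2 = 1 + ρ ^ 2)
    (x : HypSpace n) :
    ρ ^ 2 - ‖x.1 - p‖ ^ 2 = (1 - ‖x.1‖ ^ 2) * ⟪((1 : ℝ), p),toHyperboloid x⟫ := by
  have hx := (one_sub_norm_sq_pos x).ne'
  rw [lorentzForm_toHyperboloid, norm_sub_sq_real, hp, real_inner_comm]
  field_simp
  ring

theorem hypHyperplane_one_left {p : EuclideanSpace ℝ (Fin n)} {ρ : ℝ} (hρ : 0 ≤ ρ)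
    (hp : ‖p‖ ^ 2 = 1 + ρ ^ 2) : hypHyperplane (1, p) = {x | ‖x.1 - p‖ = ρ} := by
  ext x
  rw [mem_hypHyperplane, mem_ofPred_eq, ← sq_eq_sq₀ (norm_nonneg _) hρ, eq_comm (b := ρ ^ 2),
    ← sub_eq_zero (a := ρ ^ 2), sq_sub_norm_sub_sq hp, mul_eq_zero,
    or_iff_right (one_sub_norm_sq_pos x).ne']

theorem hypHalfSpace_one_left {p : EuclideanSpace ℝ (Fin n)} {ρ : ℝ} (hρ : 0 ≤ ρ)
    (hp : ‖p‖ ^ 2 = 1 + ρ ^ 2) : hypHalfSpace (1, p) = {x | ‖x.1 - p‖ ≤ ρ} := by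
  ext x
  rw [mem_hypHalfSpace, mem_ofPred_eq, ← sq_le_sq₀ (norm_nonneg _) hρ,
    ← sub_nonneg (a := ρ ^ 2), sq_sub_norm_sub_sq hp,
    mul_nonneg_iff_of_pos_left (one_sub_norm_sq_pos x)]

theorem hypHalfSpace_neg_one_left {p : EuclideanSpace ℝ (Fin n)} {ρ : ℝ} (hρ : 0 ≤ ρ)
    (hp : ‖p‖ ^ 2 = 1 + ρ ^ 2) : hypHalfSpace (-(1, p)) = {x | ρ ≤ ‖x.1 - p‖} := by
  ext x
  rw [mem_hypHalfSpace, mem_ofPred_eq, ← sq_le_sq₀ hρ (norm_nonneg _), ← sub_nonpos (b := _ ^ 2),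
    sq_sub_norm_sub_sq hp, ← neg_nonneg (a := _ * _), ← mul_neg,
    mul_nonneg_iff_of_pos_left (one_sub_norm_sq_pos x), map_neg, LinearMap.neg_apply]

theorem isHypHalfSpace_hypHalfSpace (hN : 0 < ⟪N,N⟫) :
    IsHypHalfSpace (hypHalfSpace N) (hypHyperplane N) := by
  obtain ⟨a, v⟩ := N
  rw [lorentzForm_self, sub_pos] at hN
  rcases eq_or_ne a 0 with rfl | ha
  · have hv : v ≠ 0 := by
      rintro rfl
      simp at hN
    exact .inl ⟨v, hv, hypHyperplane_zero_left v, hypHalfSpace_zero_left v⟩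
  · have hav : a • ((1 : ℝ), a⁻¹ • v) = (a, v) := by simp [ha]
    have hsq : 0 < ‖a⁻¹ • v‖ ^ 2 - 1 := by
      rw [norm_smul, mul_pow, Real.norm_eq_abs, sq_abs, inv_pow, inv_mul_eq_div, sub_pos,
        one_lt_div (by positivity)]
      exact hN
    have hρ : ‖a⁻¹ • v‖ ^ 2 = 1 + √(‖a⁻¹ • v‖ ^ 2 - 1) ^ 2 := by
      rw [Real.sq_sqrt hsq.le, add_sub_cancel]
    refine .inr ⟨a⁻¹ • v, _, Real.sqrt_pos.2 hsq, hρ, ?_, ?_⟩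
    · rw [← hypHyperplane_one_left (Real.sqrt_nonneg _) hρ, ← hav, hypHyperplane_smul ha]
    rw [← hypHalfSpace_one_left (Real.sqrt_nonneg _) hρ,
      ← hypHalfSpace_neg_one_left (Real.sqrt_nonneg _) hρ, ← hav]
    rcases ha.lt_or_gt with ha | ha
    · right
      rw [← neg_smul_neg, hypHalfSpace_smul (neg_pos.2 ha)]
    · left
      rw [hypHalfSpace_smul ha]

theorem IsHypHalfSpace.exists_normal {S H : Set (HypSpace n)} (h : IsHypHalfSpace S H) :
    ∃ N : ℝ × EuclideanSpace ℝ (Fin n),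
      0 < ⟪N,N⟫ ∧ S = hypHalfSpace N ∧ H = hypHyperplane N := by
  obtain ⟨u, hu, rfl, rfl⟩ | ⟨p, ρ, hρ, hp, rfl, hS⟩ := h
  · refine ⟨(0, u), ?_, (hypHalfSpace_zero_left u).symm, (hypHyperplane_zero_left u).symm⟩
    simpa [lorentzForm_self, sq_pos_iff] using hu
  · have hpos : 0 < ⟪((1 : ℝ), p),((1 : ℝ), p)⟫ := by
      rw [lorentzForm_self]
      simp only [hp, one_pow, add_sub_cancel_left]
      positivity
    rw [← hypHyperplane_one_left hρ.le hp]
    obtain rfl | rfl := hS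
    · exact ⟨_, hpos, (hypHalfSpace_one_left hρ.le hp).symm, rfl⟩
    · exact ⟨-(1, p), by rwa [map_neg, map_neg, LinearMap.neg_apply, neg_neg],
        (hypHalfSpace_neg_one_left hρ.le hp).symm, (hypHyperplane_neg _).symm⟩

theorem IsHypHalfSpace.exists_unit_normal {S H : Set (HypSpace n)} (h : IsHypHalfSpace S H) :
    ∃ N : ℝ × EuclideanSpace ℝ (Fin n),
      ⟪N,N⟫ = 1 ∧ S = hypHalfSpace N ∧ H = hypHyperplane N := by
  obtain ⟨N, hN, rfl, rfl⟩ := h.exists_normal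
  have hc : 0 < (√⟪N,N⟫)⁻¹ := by positivity
  refine ⟨(√⟪N,N⟫)⁻¹ • N, ?_, (hypHalfSpace_smul hc N).symm, (hypHyperplane_smul hc.ne' N).symm⟩
  simp only [map_smul, LinearMap.smul_apply, smul_eq_mul]
  rw [← mul_assoc, ← mul_inv, Real.mul_self_sqrt hN.le, inv_mul_cancel₀ hN.ne']

theorem lorentzForm_toHyperboloid_eq_mul_toKlein (N : ℝ × EuclideanSpace ℝ (Fin n))
    (x : HypSpace n) :
    ⟪N,toHyperboloid x⟫ = (toHyperboloid x).1 * (inner ℝ N.2 (toKlein x) - N.1) := by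
  rw [toHyperboloid_eq_smul x, map_smul, smul_eq_mul, lorentzForm_apply, mul_one,
    ← toHyperboloid_eq_smul]

theorem exists_isHypSupportingHyperplane (hn : 0 < n) {K : Set (HypSpace n)} (hK : IsCompact K)
    (hne : K.Nonempty) : ∃ H, IsHypSupportingHyperplane K H := by
  set e : EuclideanSpace ℝ (Fin n) := EuclideanSpace.single ⟨0, hn⟩ 1
  have he : ‖e‖ = 1 := by simp [e]
  have hcont : Continuous fun x : HypSpace n => inner ℝ e (toKlein x) :=
    continuous_const.inner continuous_toKlein
  obtain ⟨x₀, hx₀, hmin⟩ := hK.exists_isMinOn hne hcont.continuousOn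
  set c := inner ℝ e (toKlein x₀)
  have hc : c ^ 2 < 1 := by
    rw [sq_lt_one_iff_abs_lt_one]
    calc |c| ≤ ‖e‖ * ‖toKlein x₀‖ := abs_real_inner_le_norm e _
      _ < 1 := by rw [he, one_mul]; exact norm_toKlein_lt_one x₀
  have hval := lorentzForm_toHyperboloid_eq_mul_toKlein (c, e)
  refine ⟨hypHyperplane (c, e),
    ⟨hypHalfSpace (c, e), isHypHalfSpace_hypHalfSpace ?_, fun x hx => ?_⟩, x₀, hx₀, ?_⟩
  · simpa [lorentzForm_self, he, sub_pos] using hc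
  · rw [mem_hypHalfSpace, hval]
    exact mul_nonneg (toHyperboloid_fst_pos x).le (sub_nonneg.2 (hmin hx))
  · rw [mem_hypHyperplane, hval, sub_self, mul_zero]

theorem le_arsinh_of_hypClosedBall_subset {N : ℝ × EuclideanSpace ℝ (Fin n)} (hN : ⟪N,N⟫ = 1)
    {m : HypSpace n} {r : ℝ} (hr : 0 ≤ r)
    (h : hypClosedBall m r ⊆ hypHalfSpace N) :
    r ≤ Real.arsinh ⟪N,toHyperboloid m⟫ := by
  set u := Real.arsinh ⟪N,toHyperboloid m⟫
  have hNm : ⟪N,toHyperboloid m⟫ = Real.sinh u := (Real.sinh_arsinh _).symm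
  have hmN : ⟪toHyperboloid m,N⟫ = Real.sinh u := by rw [lorentzForm_comm, hNm]
  have hu0 := (Real.cosh_pos u).ne'
  have hu := Real.cosh_sq u
  -- The unit tangent vector at `m` that points straight at the boundary of the half-space.
  set V := -(Real.cosh u)⁻¹ • (N + Real.sinh u • toHyperboloid m) with hV
  have hmV : ⟪toHyperboloid m,V⟫ = 0 := by simp [hV, hmN]
  have hVV : ⟪V,V⟫ = 1 := by
    simp only [hV, map_add, map_neg, map_smul, LinearMap.add_apply, LinearMap.neg_apply,
      LinearMap.smul_apply, smul_eq_mul, hN, hNm, hmN, lorentzForm_toHyperboloid_self, neg_smul]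
    field_simp
    linear_combination -hu
  have hNV : ⟪N,V⟫ = -Real.cosh u := by
    simp only [hV, map_add, map_neg, map_smul, smul_eq_mul, hN, hNm, neg_smul]
    field_simp
    linear_combination hu
  obtain ⟨x, hx⟩ := exists_toHyperboloid_eq_cosh_smul_add_sinh_smul m hmV hVV r
  have hxm : x ∈ hypClosedBall m r := by
    refine (hypDist_le_iff hr).2 ?_
    simp [hx, hmV]
  have hNx : ⟪N,toHyperboloid x⟫ = Real.sinh (u - r) := by
    rw [hx, map_add, map_smul, map_smul, hNm, hNV, Real.sinh_sub, smul_eq_mul, smul_eq_mul]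
    ring
  have hpos : 0 ≤ ⟪N,toHyperboloid x⟫ := h hxm
  rw [hNx, Real.sinh_nonneg_iff] at hpos
  linarith

end HalfSpaces

section Lines

variable {n : ℕ} {γ : ℝ → HypSpace n}

/-- The unit tangent vector at `γ 0` of the line `γ`, as a vector of the Lorentz space that contains
the hyperboloid. It is computed from `γ 0` and `γ 1`, which avoids differentiation. -/
noncomputable def lineDirection (γ : ℝ → HypSpace n) : ℝ × EuclideanSpace ℝ (Fin n) :=
  (Real.sinh 1)⁻¹ • (toHyperboloid (γ 1) - Real.cosh 1 • toHyperboloid (γ 0))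

theorem IsHypLine.lorentzForm_toHyperboloid (hγ : IsHypLine γ) (s t : ℝ) :
    ⟪toHyperboloid (γ s),toHyperboloid (γ t)⟫ = -Real.cosh (s - t) := by
  rw [lorentzForm_eq_neg_cosh_hypDist, hγ, Real.cosh_abs]

theorem IsHypLine.lorentzForm_lineDirection (hγ : IsHypLine γ) (t : ℝ) :
    ⟪lineDirection γ,toHyperboloid (γ t)⟫ = Real.sinh t := by
  have hs : Real.sinh 1 ≠ 0 := (Real.sinh_pos_iff.2 one_pos).ne'
  simp only [lineDirection, map_sub, map_smul, LinearMap.sub_apply, LinearMap.smul_apply,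
    smul_eq_mul, hγ.lorentzForm_toHyperboloid, Real.cosh_sub, zero_sub, Real.cosh_neg]
  field_simp
  ring

theorem IsHypLine.lorentzForm_zero_lineDirection (hγ : IsHypLine γ) :
    ⟪toHyperboloid (γ 0),lineDirection γ⟫ = 0 := by
  rw [lorentzForm_comm, hγ.lorentzForm_lineDirection, Real.sinh_zero]

theorem IsHypLine.lorentzForm_lineDirection_self (hγ : IsHypLine γ) :
    ⟪lineDirection γ,lineDirection γ⟫ = 1 := by
  have hs : Real.sinh 1 ≠ 0 := (Real.sinh_pos_iff.2 one_pos).ne'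
  nth_rw 2 [lineDirection]
  simp only [map_sub, map_smul, smul_eq_mul, hγ.lorentzForm_lineDirection, Real.sinh_zero, mul_zero,
    sub_zero, inv_mul_cancel₀ hs]

theorem IsHypLine.toHyperboloid_apply (hγ : IsHypLine γ) (t : ℝ) :
    toHyperboloid (γ t) =
      Real.cosh t • toHyperboloid (γ 0) + Real.sinh t • lineDirection γ := by
  refine sub_eq_zero.1
    (eq_zero_of_lorentzForm_self_eq_zero (lorentzForm_toHyperboloid_self (γ 0)) ?_ ?_)
  · simp [hγ.lorentzForm_toHyperboloid, hγ.lorentzForm_zero_lineDirection]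
  · simp only [map_add, map_sub, map_smul, LinearMap.add_apply, LinearMap.sub_apply,
      LinearMap.smul_apply, smul_eq_mul, hγ.lorentzForm_toHyperboloid,
      hγ.lorentzForm_lineDirection, hγ.lorentzForm_lineDirection_self,
      lorentzForm_comm _ (lineDirection γ), sub_zero, zero_sub, sub_self, Real.cosh_zero,
      Real.cosh_neg, Real.sinh_zero]
    linear_combination Real.cosh_sq t

theorem IsHypLine.dim_pos (hγ : IsHypLine γ) : 0 < n := by
  rw [Nat.pos_iff_ne_zero]
  rintro rfl
  have h := hγ 0 1
  rw [Subsingleton.elim (γ 1) (γ 0)] at h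
  norm_num at h

theorem exists_isHypLine (hn : 0 < n) : ∃ γ : ℝ → HypSpace n, IsHypLine γ := by
  let o : HypSpace n := ⟨0, Metric.mem_ball_self one_pos⟩
  let V : ℝ × EuclideanSpace ℝ (Fin n) := (0, EuclideanSpace.single ⟨0, hn⟩ 1)
  have hV : ⟪V,V⟫ = 1 := by simp [V, lorentzForm_self]
  have hoV : ⟪toHyperboloid o,V⟫ = 0 := by simp [o, V, toHyperboloid, lorentzForm_apply]
  choose γ hγ using exists_toHyperboloid_eq_cosh_smul_add_sinh_smul o hoV hV
  refine ⟨γ, fun s t => ?_⟩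
  have hst : -⟪toHyperboloid (γ s),toHyperboloid (γ t)⟫ = Real.cosh |s - t| := by
    simp only [hγ, map_add, map_smul, LinearMap.add_apply, LinearMap.smul_apply, smul_eq_mul,
      lorentzForm_comm V, hoV, hV, lorentzForm_toHyperboloid_self, Real.cosh_abs, Real.cosh_sub]
    ring
  rw [hypDist_eq_arcosh, hst, Real.arcosh_cosh (abs_nonneg _)]

end Lines

section Width

variable {n : ℕ} {γ : ℝ → HypSpace n} {K H : Set (HypSpace n)}

theorem hypInfDist_le {x y : HypSpace n} (hy : y ∈ H) : hypInfDist x H ≤ hypDist x y :=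
  csInf_le ⟨0, forall_mem_image.2 fun z _ => hypDist_nonneg x z⟩ (mem_image_of_mem _ hy)

theorem hypInfDist_le_lassakWidthAt (hK : IsCompact K) (hH : H.Nonempty) {x : HypSpace n}
    (hx : x ∈ K) : hypInfDist x H ≤ lassakWidthAt K H := by
  obtain ⟨y, hy⟩ := hH
  obtain ⟨R, hR⟩ := (hK.image (continuous_hypDist y)).bddAbove
  refine le_csSup ⟨R, forall_mem_image.2 fun z hz => ?_⟩ (mem_image_of_mem _ hx)
  calc hypInfDist z H ≤ hypDist z y := hypInfDist_le hy
    _ = hypDist y z := hypDist_comm z y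
    _ ≤ R := hR (mem_image_of_mem _ hz)

theorem arsinh_lorentzForm_le_hypInfDist {N : ℝ × EuclideanSpace ℝ (Fin n)} (hN : ⟪N,N⟫ = 1)
    (hne : (hypHyperplane N).Nonempty) (x : HypSpace n) :
    Real.arsinh ⟪N,toHyperboloid x⟫ ≤ hypInfDist x (hypHyperplane N) := by
  refine le_csInf (hne.image _) (forall_mem_image.2 fun y hy => ?_)
  rw [← Real.sinh_le_sinh, Real.sinh_arsinh]
  exact (le_abs_self _).trans (abs_lorentzForm_le_sinh_hypDist hN hy)

theorem IsHypLine.lorentzForm_add_lorentzForm_neg (hγ : IsHypLine γ)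
    (N : ℝ × EuclideanSpace ℝ (Fin n)) (a : ℝ) :
    ⟪N,toHyperboloid (γ a)⟫ + ⟪N,toHyperboloid (γ (-a))⟫ =
      2 * (⟪N,toHyperboloid (γ 0)⟫ * Real.cosh a) := by
  rw [hγ.toHyperboloid_apply a, hγ.toHyperboloid_apply (-a)]
  simp only [map_add, map_smul, smul_eq_mul, Real.cosh_neg, Real.sinh_neg]
  ring

theorem IsHypLine.arsinh_le_minLassakWidth (hγ : IsHypLine γ) (hK : IsCompact K) {r a : ℝ}
    (hr : 0 ≤ r) (hball : hypClosedBall (γ 0) r ⊆ K) (hends : {γ (-a), γ a} ⊆ K) :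
    Real.arsinh (Real.sinh r * Real.cosh a) ≤ minLassakWidth K := by
  rw [insert_subset_iff, singleton_subset_iff] at hends
  obtain ⟨H₀, hH₀⟩ := exists_isHypSupportingHyperplane hγ.dim_pos hK ⟨_, hends.1⟩
  refine le_csInf ⟨_, mem_image_of_mem _ hH₀⟩ (forall_mem_image.2 fun H hH => ?_)
  obtain ⟨⟨S, hS, hKS⟩, hKH⟩ := hH
  obtain ⟨N, hN, rfl, rfl⟩ := hS.exists_unit_normal
  have hne : (hypHyperplane N).Nonempty := hKH.mono inter_subset_right
  have hm : Real.sinh r ≤ ⟪N,toHyperboloid (γ 0)⟫ := by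
    rw [← Real.sinh_arsinh ⟪N,toHyperboloid (γ 0)⟫, Real.sinh_le_sinh]
    exact le_arsinh_of_hypClosedBall_subset hN hr (hball.trans hKS)
  -- `m` is the midpoint of the tips, so that the mean of their Lorentz products with `N` is
  -- `cosh a` times that of `m`.
  have htip : ∃ x ∈ K, Real.sinh r * Real.cosh a ≤ ⟪N,toHyperboloid x⟫ := by
    have hsum := hγ.lorentzForm_add_lorentzForm_neg N a
    have hmul := mul_le_mul_of_nonneg_right hm (Real.cosh_pos a).le
    by_contra! hlt
    linarith [hlt _ hends.1, hlt _ hends.2]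
  obtain ⟨x, hxK, hx⟩ := htip
  calc Real.arsinh (Real.sinh r * Real.cosh a)
      ≤ Real.arsinh ⟪N,toHyperboloid x⟫ := Real.arsinh_le_arsinh.2 hx
    _ ≤ hypInfDist x (hypHyperplane N) := arsinh_lorentzForm_le_hypInfDist hN hne x
    _ ≤ lassakWidthAt K (hypHyperplane N) := hypInfDist_le_lassakWidthAt hK hne hxK

theorem IsHypLine.arsinh_le_minLassakWidth_hypSpindle (hγ : IsHypLine γ) {r : ℝ} (hr : 0 < r)
    (a : ℝ) : Real.arsinh (Real.sinh r * Real.cosh a) ≤ minLassakWidth (hypSpindle γ r a) :=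
  hγ.arsinh_le_minLassakWidth (isHypConvexBody_hypSpindle γ hr a).1 hr.le
    (subset_union_left.trans (subset_hypConvexHull _))
    (subset_union_right.trans (subset_hypConvexHull _))

/-- The half-length `g(r)` of the spindle around a ball of radius `r` whose width is at least
`1 / r`: any `a > 1` with `sinh (1 / r) ≤ sinh r * cosh a` would do. -/
noncomputable def spindleLength (r : ℝ) : ℝ :=
  2 + Real.sinh (1 / r) / Real.sinh r

theorem one_lt_spindleLength {r : ℝ} (hr : 0 < r) : 1 < spindleLength r := by
  have h₁ : 0 < Real.sinh r := Real.sinh_pos_iff.2 hr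
  have h₂ : 0 < Real.sinh (1 / r) := Real.sinh_pos_iff.2 (one_div_pos.2 hr)
  have h : 0 < Real.sinh (1 / r) / Real.sinh r := div_pos h₂ h₁
  unfold spindleLength
  linarith

theorem sinh_one_div_le_sinh_mul_cosh_spindleLength {r : ℝ} (hr : 0 < r) :
    Real.sinh (1 / r) ≤ Real.sinh r * Real.cosh (spindleLength r) := by
  have hs : 0 < Real.sinh r := Real.sinh_pos_iff.2 hr
  rw [← div_le_iff₀' hs]
  calc Real.sinh (1 / r) / Real.sinh r
      ≤ spindleLength r := le_add_of_nonneg_left zero_le_two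
    _ ≤ Real.sinh (spindleLength r) :=
        Real.self_le_sinh_iff.2 (one_pos.trans (one_lt_spindleLength hr)).le
    _ ≤ Real.cosh (spindleLength r) := (Real.sinh_lt_cosh _).le

theorem IsHypLine.one_div_le_minLassakWidth_hypSpindle (hγ : IsHypLine γ) {r : ℝ} (hr : 0 < r) :
    1 / r ≤ minLassakWidth (hypSpindle γ r (spindleLength r)) := by
  refine le_trans ?_ (hγ.arsinh_le_minLassakWidth_hypSpindle hr _)
  rw [← Real.arsinh_sinh (1 / r), Real.arsinh_le_arsinh]
  exact sinh_one_div_le_sinh_mul_cosh_spindleLength hr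

end Width

theorem cosh_sub_abs_sinh (t : ℝ) : Real.cosh t - |Real.sinh t| = Real.exp (-|t|) := by
  rw [Real.abs_sinh, ← Real.cosh_abs t, Real.cosh_sub_sinh]

theorem sinh_le_two_mul_mul_exp_neg {r : ℝ} (hr : 0 ≤ r) (hr1 : r ≤ 1 / 2) :
    Real.sinh r ≤ 2 * r * Real.exp (-r) := by
  have habs : |2 * r| = 2 * r := abs_of_nonneg (by positivity)
  have hexp : Real.exp (2 * r) - 1 ≤ 2 * (2 * r) := by
    have h := Real.abs_exp_sub_one_le (x := 2 * r) (by rw [habs]; linarith)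
    rw [habs] at h
    exact (le_abs_self _).trans h
  have hsinh : Real.sinh r = (Real.exp (2 * r) - 1) * Real.exp (-r) / 2 := by
    rw [Real.sinh_eq, sub_mul, ← Real.exp_add, one_mul]
    ring_nf
  rw [hsinh]
  linarith [mul_le_mul_of_nonneg_right hexp (Real.exp_pos (-r)).le]

section CuspNeighborhood

variable {n : ℕ} {γ : ℝ → HypSpace n} {ε : ℝ}

/-- A neighborhood of the line `γ` that narrows towards its two ends: it consists of the points `x`
with `tanh (d(x, γ t)) ≤ ε * exp (-|t|)`, where `γ t` is the foot of the perpendicular from `x`. The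
defining inequality is written in a form in which its convexity is a triangle inequality. -/
def cuspNeighborhood (γ : ℝ → HypSpace n) (ε : ℝ) : Set (HypSpace n) :=
  {x | √(lorentzPerpPlane (toHyperboloid (γ 0)) (lineDirection γ) (toHyperboloid x)
      (toHyperboloid x)) ≤
    ε * (-⟪toHyperboloid (γ 0),toHyperboloid x⟫ - |⟪lineDirection γ,toHyperboloid x⟫|)}

theorem IsHypLine.lorentzPerpPlane_self_nonneg (hγ : IsHypLine γ)
    (X : ℝ × EuclideanSpace ℝ (Fin n)) :
    0 ≤ lorentzPerpPlane (toHyperboloid (γ 0)) (lineDirection γ) X X :=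
  _root_.lorentzPerpPlane_self_nonneg (lorentzForm_toHyperboloid_self _)
    hγ.lorentzForm_lineDirection_self hγ.lorentzForm_zero_lineDirection X

theorem IsHypLine.hypConvex_cuspNeighborhood (hγ : IsHypLine γ) (hε : 0 ≤ ε) :
    HypConvex (cuspNeighborhood γ ε) := by
  intro x hx y hy z hz
  obtain ⟨a, b, ha, hb, hz⟩ := mem_hypSegment_iff_toHyperboloid.1 hz
  set M := toHyperboloid (γ 0)
  set U := lineDirection γ
  set X := toHyperboloid x
  set Y := toHyperboloid y
  set B := lorentzPerpPlane M U
  have habs : |⟪U,a • X + b • Y⟫| ≤ a * |⟪U,X⟫| + b * |⟪U,Y⟫| := by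
    have h := abs_add_le (a * ⟪U,X⟫) (b * ⟪U,Y⟫)
    rw [abs_mul, abs_mul, abs_of_nonneg ha, abs_of_nonneg hb] at h
    simpa only [map_add, map_smul, smul_eq_mul] using h
  change √(B (toHyperboloid z) (toHyperboloid z)) ≤
    ε * (-⟪M,toHyperboloid z⟫ - |⟪U,toHyperboloid z⟫|)
  rw [hz]
  calc √(B (a • X + b • Y) (a • X + b • Y))
      ≤ √(B (a • X) (a • X)) + √(B (b • Y) (b • Y)) :=
        sqrt_apply_add_self_le hγ.lorentzPerpPlane_self_nonneg (lorentzPerpPlane_isSymm M U) _ _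
    _ = a * √(B X X) + b * √(B Y Y) := by
        rw [sqrt_apply_smul_self ha, sqrt_apply_smul_self hb]
    _ ≤ a * (ε * (-⟪M,X⟫ - |⟪U,X⟫|)) + b * (ε * (-⟪M,Y⟫ - |⟪U,Y⟫|)) :=
        add_le_add (mul_le_mul_of_nonneg_left hx ha) (mul_le_mul_of_nonneg_left hy hb)
    _ = ε * (-⟪M,a • X + b • Y⟫ - (a * |⟪U,X⟫| + b * |⟪U,Y⟫|)) := by
        simp only [map_add, map_smul, smul_eq_mul]
        ring
    _ ≤ ε * (-⟪M,a • X + b • Y⟫ - |⟪U,a • X + b • Y⟫|) := by gcongr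

theorem IsHypLine.mem_cuspNeighborhood (hγ : IsHypLine γ) (hε : 0 ≤ ε) (t : ℝ) :
    γ t ∈ cuspNeighborhood γ ε := by
  have hB : lorentzPerpPlane (toHyperboloid (γ 0)) (lineDirection γ) (toHyperboloid (γ t))
      (toHyperboloid (γ t)) = 0 := by
    rw [lorentzPerpPlane_apply, lorentzForm_toHyperboloid_self, hγ.lorentzForm_toHyperboloid,
      hγ.lorentzForm_lineDirection, zero_sub, Real.cosh_neg]
    linear_combination Real.cosh_sq t
  simp only [cuspNeighborhood, mem_ofPred_eq]
  rw [hB, Real.sqrt_zero, hγ.lorentzForm_toHyperboloid, hγ.lorentzForm_lineDirection, zero_sub,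
    Real.cosh_neg, neg_neg, cosh_sub_abs_sinh]
  positivity

theorem IsHypLine.hypClosedBall_subset_cuspNeighborhood (hγ : IsHypLine γ) {r : ℝ}
    (hr : r ≤ 1 / 2) : hypClosedBall (γ 0) r ⊆ cuspNeighborhood γ (2 * r) := by
  intro x (hx : hypDist (γ 0) x ≤ r)
  have hB := hγ.lorentzPerpPlane_self_nonneg (toHyperboloid x)
  simp only [cuspNeighborhood, mem_ofPred_eq]
  rw [lorentzPerpPlane_apply, lorentzForm_toHyperboloid_self, lorentzForm_eq_neg_cosh_hypDist,
    neg_mul_neg, ← sq, ← sq] at hB ⊢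
  rw [neg_neg]
  have hsinh := sinh_hypDist_nonneg (γ 0) x
  have hd := hypDist_nonneg (γ 0) x
  set d := hypDist (γ 0) x
  set S := ⟪lineDirection γ,toHyperboloid x⟫
  have hcosh := Real.cosh_sq d
  have hr0 : 0 ≤ r := hd.trans hx
  have hS : |S| ≤ Real.sinh d := abs_le_of_sq_le_sq (by linarith) hsinh
  calc √(-1 + Real.cosh d ^ 2 - S ^ 2)
      ≤ Real.sinh d := (Real.sqrt_le_left hsinh).2 (by linarith [sq_nonneg S])
    _ ≤ Real.sinh r := Real.sinh_le_sinh.2 hx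
    _ ≤ 2 * r * Real.exp (-r) := sinh_le_two_mul_mul_exp_neg hr0 hr
    _ ≤ 2 * r * Real.exp (-d) := by gcongr
    _ = 2 * r * (Real.cosh d - Real.sinh d) := by rw [Real.cosh_sub_sinh]
    _ ≤ 2 * r * (Real.cosh d - |S|) := by gcongr

theorem IsHypLine.exists_foot (hγ : IsHypLine γ) (x : HypSpace n) :
    ∃ t, -⟪toHyperboloid (γ 0),toHyperboloid x⟫ = Real.cosh (hypDist x (γ t)) * Real.cosh t ∧
      ⟪lineDirection γ,toHyperboloid x⟫ = Real.cosh (hypDist x (γ t)) * Real.sinh t := by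
  have hB := hγ.lorentzPerpPlane_self_nonneg (toHyperboloid x)
  rw [lorentzPerpPlane_apply, lorentzForm_toHyperboloid_self, ← neg_mul_neg, ← sq, ← sq] at hB
  have hT := one_le_neg_lorentzForm_toHyperboloid (γ 0) x
  set T := -⟪toHyperboloid (γ 0),toHyperboloid x⟫ with hT'
  set S := ⟪lineDirection γ,toHyperboloid x⟫
  have hpos : 0 < T ^ 2 - S ^ 2 := by linarith
  set R := √(T ^ 2 - S ^ 2)
  have hR : 0 < R := Real.sqrt_pos.2 hpos
  have hRsq : R ^ 2 = T ^ 2 - S ^ 2 := Real.sq_sqrt hpos.le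
  have hsinh : Real.sinh (Real.arsinh (S / R)) = S / R := Real.sinh_arsinh _
  have hcosh : Real.cosh (Real.arsinh (S / R)) = T / R := by
    rw [← sq_eq_sq₀ (Real.cosh_pos _).le (by positivity), Real.cosh_sq, hsinh]
    field_simp
    linarith
  have hdist : Real.cosh (hypDist x (γ (Real.arsinh (S / R)))) = R := by
    rw [hypDist_comm, ← neg_eq_iff_eq_neg.2 (lorentzForm_eq_neg_cosh_hypDist _ x),
      hγ.toHyperboloid_apply, hcosh, hsinh]
    simp only [map_add, map_smul, LinearMap.add_apply, LinearMap.smul_apply, smul_eq_mul]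
    change -(T / R * ⟪toHyperboloid (γ 0),toHyperboloid x⟫ + S / R * S) = R
    rw [neg_eq_iff_eq_neg.1 hT'.symm]
    field_simp
    linarith
  refine ⟨Real.arsinh (S / R), ?_, ?_⟩
  · rw [hdist, hcosh, mul_div_cancel₀ _ hR.ne']
  · rw [hdist, hsinh, mul_div_cancel₀ _ hR.ne']

theorem IsHypLine.exists_sinh_hypDist_le_of_mem_cuspNeighborhood (hγ : IsHypLine γ)
    {x : HypSpace n} (hx : x ∈ cuspNeighborhood γ ε) :
    ∃ t, Real.sinh (hypDist x (γ t)) ≤ ε * (Real.cosh (hypDist x (γ t)) * Real.exp (-|t|)) := by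
  obtain ⟨t, hcosh, hsinh⟩ := hγ.exists_foot x
  refine ⟨t, ?_⟩
  have hc := Real.cosh_pos (hypDist x (γ t))
  have hB : lorentzPerpPlane (toHyperboloid (γ 0)) (lineDirection γ) (toHyperboloid x)
      (toHyperboloid x) = Real.sinh (hypDist x (γ t)) ^ 2 := by
    rw [lorentzPerpPlane_apply, lorentzForm_toHyperboloid_self, ← neg_mul_neg, hcosh, hsinh,
      Real.sinh_sq]
    linear_combination Real.cosh (hypDist x (γ t)) ^ 2 * Real.cosh_sq t
  simp only [cuspNeighborhood, mem_ofPred_eq] at hx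
  rwa [hB, Real.sqrt_sq (sinh_hypDist_nonneg _ _), hcosh, hsinh, abs_mul, abs_of_pos hc, ← mul_sub,
    cosh_sub_abs_sinh] at hx

theorem IsHypLine.exists_hypDist_le_of_mem_cuspNeighborhood (hγ : IsHypLine γ) (hε : 0 ≤ ε)
    (hε1 : ε ≤ 1 / 2) {x : HypSpace n} (hx : x ∈ cuspNeighborhood γ ε) :
    ∃ t, hypDist x (γ t) ≤ 2 * ε * Real.exp (-|t|) := by
  obtain ⟨t, ht⟩ := hγ.exists_sinh_hypDist_le_of_mem_cuspNeighborhood hx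
  refine ⟨t, ?_⟩
  have hs := sinh_hypDist_nonneg x (γ t)
  have hc := Real.cosh_pos (hypDist x (γ t))
  have hexp : Real.exp (-|t|) ≤ 1 := Real.exp_le_one_iff.2 (by simp)
  have htanh : Real.sinh (hypDist x (γ t)) ≤ Real.cosh (hypDist x (γ t)) / 2 :=
    calc Real.sinh (hypDist x (γ t)) ≤ ε * (Real.cosh (hypDist x (γ t)) * Real.exp (-|t|)) := ht
      _ ≤ 1 / 2 * (Real.cosh (hypDist x (γ t)) * 1) := by gcongr
      _ = Real.cosh (hypDist x (γ t)) / 2 := by ring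
  have hcosh : Real.cosh (hypDist x (γ t)) ≤ 2 := by
    have hsq := Real.cosh_sq (hypDist x (γ t))
    nlinarith
  calc hypDist x (γ t) ≤ Real.sinh (hypDist x (γ t)) :=
        Real.self_le_sinh_iff.2 (hypDist_nonneg _ _)
    _ ≤ ε * (Real.cosh (hypDist x (γ t)) * Real.exp (-|t|)) := ht
    _ ≤ ε * (2 * Real.exp (-|t|)) := by gcongr
    _ = 2 * ε * Real.exp (-|t|) := by ring

end CuspNeighborhood

section Covering

theorem exists_nat_log_le_le_add {r t : ℝ} (hr : 0 < r) (ht : 0 ≤ t) : ∃ i : ℕ,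
    Real.log (1 + r * i) ≤ t ∧ t ≤ Real.log (1 + r * i) + r / (1 + r * i) := by
  have hnonneg : 0 ≤ (Real.exp t - 1) / r :=
    div_nonneg (sub_nonneg.2 (Real.one_le_exp ht)) hr.le
  have hfloor := Nat.floor_le hnonneg
  have hlt := Nat.lt_floor_add_one ((Real.exp t - 1) / r)
  set i := ⌊(Real.exp t - 1) / r⌋₊
  rw [le_div_iff₀ hr] at hfloor
  rw [div_lt_iff₀ hr] at hlt
  have hpos : 0 < 1 + r * i := by positivity
  refine ⟨i, (Real.log_le_iff_le_exp hpos).2 (by linarith), Real.exp_le_exp.1 ?_⟩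
  calc Real.exp t ≤ (1 + r * i) * (r / (1 + r * i) + 1) := by
        rw [mul_add, mul_div_cancel₀ _ hpos.ne']
        linarith
    _ ≤ (1 + r * i) * Real.exp (r / (1 + r * i)) := by
        gcongr
        exact Real.add_one_le_exp _
    _ = Real.exp (Real.log (1 + r * i) + r / (1 + r * i)) := by
        rw [Real.exp_add, Real.exp_log hpos]

variable {n : ℕ} {γ : ℝ → HypSpace n}

theorem IsHypLine.hypSpindle_subset_cuspNeighborhood (hγ : IsHypLine γ) {r : ℝ} (hr : 0 ≤ r)
    (hr1 : r ≤ 1 / 2) (a : ℝ) : hypSpindle γ r a ⊆ cuspNeighborhood γ (2 * r) := by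
  have hr2 : 0 ≤ 2 * r := by positivity
  refine hypConvexHull_subset (hγ.hypConvex_cuspNeighborhood hr2)
    (union_subset (hγ.hypClosedBall_subset_cuspNeighborhood hr1) ?_)
  rintro _ (rfl | rfl) <;> exact hγ.mem_cuspNeighborhood hr2 _

theorem IsHypLine.hypSpindle_subset_iUnion (hγ : IsHypLine γ) {r : ℝ} (hr : 0 < r)
    (hr1 : r ≤ 1 / 4) (a : ℝ) :
    hypSpindle γ r a ⊆ ⋃ i : ℕ,
      hypClosedBall (γ (Real.log (1 + r * i))) (5 * r / (1 + r * i)) ∪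
        hypClosedBall (γ (-Real.log (1 + r * i))) (5 * r / (1 + r * i)) := by
  intro x hx
  obtain ⟨t, ht⟩ := hγ.exists_hypDist_le_of_mem_cuspNeighborhood (by positivity) (by linarith)
    (hγ.hypSpindle_subset_cuspNeighborhood hr.le (by linarith) a hx)
  obtain ⟨i, hlog, hlog'⟩ := exists_nat_log_le_le_add hr (abs_nonneg t)
  have hpos : 0 < 1 + r * i := by positivity
  have hexp : Real.exp (-|t|) ≤ (1 + r * i)⁻¹ := by
    rw [Real.exp_neg]
    exact inv_anti₀ hpos ((Real.log_le_iff_le_exp hpos).1 hlog)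
  have hmem : ∀ s : ℝ, |s - t| ≤ r / (1 + r * i) →
      x ∈ hypClosedBall (γ s) (5 * r / (1 + r * i)) := fun s hs =>
    calc hypDist (γ s) x ≤ hypDist (γ s) (γ t) + hypDist (γ t) x := hypDist_triangle _ _ _
      _ = |s - t| + hypDist x (γ t) := by rw [hγ, hypDist_comm]
      _ ≤ r / (1 + r * i) + 2 * (2 * r) * (1 + r * i)⁻¹ := by grw [hs, ht, hexp]
      _ = 5 * r / (1 + r * i) := by ring
  refine mem_iUnion.2 ⟨i, ?_⟩
  rcases le_total 0 t with h | h
  · rw [abs_of_nonneg h] at hlog hlog'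
    exact Or.inl (hmem _ (abs_le.2 ⟨by linarith, by linarith [div_pos hr hpos]⟩))
  · rw [abs_of_nonpos h] at hlog hlog'
    exact Or.inr (hmem _ (abs_le.2 ⟨by linarith [div_pos hr hpos], by linarith⟩))

end Covering

section Volume

variable {n : ℕ}

theorem cosh_sub_one_le_sq {ρ : ℝ} (hρ : |ρ| ≤ 1) : Real.cosh ρ - 1 ≤ ρ ^ 2 := by
  have hsq : ρ ^ 2 ≤ 1 := sq_le_one_iff_abs_le_one ρ |>.2 hρ
  have habs : |ρ ^ 2 / 2| = ρ ^ 2 / 2 := abs_of_nonneg (by positivity)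
  have hexp := Real.abs_exp_sub_one_le (x := ρ ^ 2 / 2) (by rw [habs]; linarith)
  rw [habs] at hexp
  linarith [Real.cosh_le_exp_half_sq ρ, le_abs_self (Real.exp (ρ ^ 2 / 2) - 1)]

theorem two_mul_norm_sub_sq_le_of_hypDist_le {c x : HypSpace n} {ρ : ℝ} (hρ : ρ ≤ 1)
    (h : hypDist c x ≤ ρ) :
    2 * ‖c.1 - x.1‖ ^ 2 ≤ ρ ^ 2 * ((1 - ‖c.1‖ ^ 2) * (1 - ‖x.1‖ ^ 2)) := by
  have hc := one_sub_norm_sq_pos c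
  have hx := one_sub_norm_sq_pos x
  have hρ0 : 0 ≤ ρ := (hypDist_nonneg c x).trans h
  rw [hypDist_le_iff hρ0, neg_lorentzForm_toHyperboloid_toHyperboloid, ← le_sub_iff_add_le',
    div_le_iff₀ (by positivity)] at h
  refine h.trans ?_
  gcongr
  exact cosh_sub_one_le_sq (by rwa [abs_of_nonneg hρ0])

theorem one_sub_norm_sq_le_of_hypDist_le_one {c x : HypSpace n} (h : hypDist c x ≤ 1) :
    1 - ‖c.1‖ ^ 2 ≤ 4 * (1 - ‖x.1‖ ^ 2) := by
  have hc := one_sub_norm_sq_pos c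
  have hx := one_sub_norm_sq_pos x
  have hc1 : ‖c.1‖ < 1 := mem_ball_zero_iff.1 c.2
  have hx1 : ‖x.1‖ < 1 := mem_ball_zero_iff.1 x.2
  have hnorm := two_mul_norm_sub_sq_le_of_hypDist_le le_rfl h
  have hsub : |(1 - ‖c.1‖ ^ 2) - (1 - ‖x.1‖ ^ 2)| ≤ 2 * ‖c.1 - x.1‖ :=
    calc |(1 - ‖c.1‖ ^ 2) - (1 - ‖x.1‖ ^ 2)|
        = (‖c.1‖ + ‖x.1‖) * |‖c.1‖ - ‖x.1‖| := by
          rw [← abs_of_nonneg (a := ‖c.1‖ + ‖x.1‖) (by positivity), ← abs_mul, ← abs_neg]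
          ring_nf
      _ ≤ 2 * ‖c.1 - x.1‖ := by
          gcongr
          · linarith
          · exact abs_norm_sub_norm_le _ _
  have hsq := sq_le_sq' (neg_le_of_abs_le hsub) (le_of_abs_le hsub)
  by_contra! hlt
  nlinarith

theorem norm_sub_le_of_hypDist_le {c x : HypSpace n} {ρ : ℝ} (hρ : ρ ≤ 1)
    (h : hypDist c x ≤ ρ) : ‖c.1 - x.1‖ ≤ 2 * ρ * (1 - ‖c.1‖ ^ 2) := by
  have hc := one_sub_norm_sq_pos c
  have hρ0 : 0 ≤ ρ := (hypDist_nonneg c x).trans h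
  have hx : 1 - ‖x.1‖ ^ 2 ≤ 4 * (1 - ‖c.1‖ ^ 2) :=
    one_sub_norm_sq_le_of_hypDist_le_one (by rw [hypDist_comm]; exact h.trans hρ)
  refine le_of_sq_le_sq ?_ (by positivity)
  calc ‖c.1 - x.1‖ ^ 2 ≤ 2 * ‖c.1 - x.1‖ ^ 2 := by linarith [sq_nonneg ‖c.1 - x.1‖]
    _ ≤ ρ ^ 2 * ((1 - ‖c.1‖ ^ 2) * (1 - ‖x.1‖ ^ 2)) :=
        two_mul_norm_sub_sq_le_of_hypDist_le hρ h
    _ ≤ ρ ^ 2 * ((1 - ‖c.1‖ ^ 2) * (4 * (1 - ‖c.1‖ ^ 2))) := by gcongr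
    _ = (2 * ρ * (1 - ‖c.1‖ ^ 2)) ^ 2 := by ring

theorem hypVolume_hypClosedBall_le (c : HypSpace n) {ρ : ℝ} (hρ : 0 ≤ ρ) (hρ1 : ρ ≤ 1) :
    hypVolume n (hypClosedBall c ρ) ≤ ENNReal.ofReal ((16 * ρ) ^ n) *
      volume (Metric.ball (0 : EuclideanSpace ℝ (Fin n)) 1) := by
  have hc := one_sub_norm_sq_pos c
  set A := 1 - ‖c.1‖ ^ 2
  have hmeas : MeasurableSet (hypClosedBall c ρ) := (isClosed_hypClosedBall c ρ).measurableSet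
  have hdensity : ∀ x ∈ hypClosedBall c ρ,
      ENNReal.ofReal ((2 / (1 - ‖x.1‖ ^ 2)) ^ n) ≤ ENNReal.ofReal ((8 / A) ^ n) := by
    intro x hx
    have hx0 := one_sub_norm_sq_pos x
    have hAx := one_sub_norm_sq_le_of_hypDist_le_one (le_trans hx hρ1)
    gcongr ENNReal.ofReal (?_ ^ n)
    rw [div_le_div_iff₀ hx0 hc]
    linarith
  have himage : Measure.comap Subtype.val (volume : Measure (EuclideanSpace ℝ (Fin n)))
      (hypClosedBall c ρ) ≤ volume (Metric.closedBall c.1 (2 * ρ * A)) := by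
    rw [comap_subtype_coe_apply Metric.isOpen_ball.measurableSet]
    refine measure_mono (image_subset_iff.2 fun x hx => ?_)
    exact mem_closedBall_iff_norm'.2 (norm_sub_le_of_hypDist_le hρ1 hx)
  calc hypVolume n (hypClosedBall c ρ)
      ≤ ∫⁻ _ in hypClosedBall c ρ, ENNReal.ofReal ((8 / A) ^ n)
          ∂Measure.comap Subtype.val (volume : Measure (EuclideanSpace ℝ (Fin n))) := by
        rw [hypVolume, withDensity_apply _ hmeas]
        exact setLIntegral_mono' hmeas hdensity
    _ ≤ ENNReal.ofReal ((8 / A) ^ n) * volume (Metric.closedBall c.1 (2 * ρ * A)) := by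
        rw [setLIntegral_const]
        gcongr
    _ = ENNReal.ofReal ((8 / A * (2 * ρ * A)) ^ n) *
          volume (Metric.ball (0 : EuclideanSpace ℝ (Fin n)) 1) := by
        rw [Measure.addHaar_closedBall _ _ (by positivity), ← mul_assoc,
          ← ENNReal.ofReal_mul (by positivity), finrank_euclideanSpace_fin, ← mul_pow]
    _ = ENNReal.ofReal ((16 * ρ) ^ n) *
          volume (Metric.ball (0 : EuclideanSpace ℝ (Fin n)) 1) := by
        congr 3
        field_simp
        ring

theorem sum_range_sq_div_le {r : ℝ} (hr : 0 ≤ r) (N : ℕ) :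
    ∑ i ∈ Finset.range N, (r / (1 + r * i)) ^ 2 ≤ r ^ 2 + r := by
  have htele : ∀ i : ℕ,
      (r / (1 + r * (i + 1))) ^ 2 ≤ r / (1 + r * i) - r / (1 + r * (i + 1)) := by
    intro i
    calc (r / (1 + r * (i + 1))) ^ 2
        = r ^ 2 / ((1 + r * (i + 1)) * (1 + r * (i + 1))) := by rw [div_pow, sq (1 + r * _)]
      _ ≤ r ^ 2 / ((1 + r * i) * (1 + r * (i + 1))) := by
          gcongr
          exact le_add_of_nonneg_right zero_le_one
      _ = r / (1 + r * i) - r / (1 + r * (i + 1)) := by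
          field_simp
          ring
  calc ∑ i ∈ Finset.range N, (r / (1 + r * i)) ^ 2
      ≤ ∑ i ∈ Finset.range (N + 1), (r / (1 + r * i)) ^ 2 :=
        Finset.sum_le_sum_of_subset_of_nonneg (Finset.range_mono N.le_succ)
          fun _ _ _ => sq_nonneg _
    _ ≤ r ^ 2 + ∑ i ∈ Finset.range N, (r / (1 + r * i) - r / (1 + r * (i + 1))) := by
        rw [Finset.sum_range_succ', add_comm]
        push_cast
        gcongr with i
        · simp
        · exact htele i
    _ = r ^ 2 + (r - r / (1 + r * N)) := by
        have h := Finset.sum_range_sub' (fun i : ℕ => r / (1 + r * i)) N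
        push_cast at h
        rw [h, mul_zero, add_zero, div_one]
    _ ≤ r ^ 2 + r := by
        gcongr
        exact sub_le_self _ (by positivity)

theorem IsHypLine.hypVolume_hypSpindle_le {γ : ℝ → HypSpace n} (hγ : IsHypLine γ) (hn : 2 ≤ n)
    {r : ℝ} (hr : 0 < r) (hr1 : r ≤ 1 / 5) (a : ℝ) :
    hypVolume n (hypSpindle γ r a) ≤ ENNReal.ofReal (2 * 80 ^ n * (r ^ 2 + r)) *
      volume (Metric.ball (0 : EuclideanSpace ℝ (Fin n)) 1) := by
  set ω := volume (Metric.ball (0 : EuclideanSpace ℝ (Fin n)) 1)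
  set b : ℕ → ℝ := fun i => (r / (1 + r * i)) ^ 2
  have hsummable : Summable b :=
    summable_of_sum_range_le (fun _ => sq_nonneg _) (sum_range_sq_div_le hr.le)
  have htsum : ∑' i, b i ≤ r ^ 2 + r :=
    Real.tsum_le_of_sum_range_le (fun _ => sq_nonneg _) (sum_range_sq_div_le hr.le)
  have hball : ∀ (i : ℕ) (c : HypSpace n), hypVolume n (hypClosedBall c (5 * r / (1 + r * i))) ≤
      ENNReal.ofReal (80 ^ n * b i) * ω := by
    intro i c
    have hle : r / (1 + r * i) ≤ r := div_le_self hr.le (le_add_of_nonneg_right (by positivity))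
    have heq : 5 * r / (1 + r * i) = 5 * (r / (1 + r * i)) := mul_div_assoc _ _ _
    refine (hypVolume_hypClosedBall_le c (by positivity) (by linarith)).trans ?_
    rw [heq, ← mul_assoc, mul_pow]
    norm_num only
    gcongr
    exact pow_le_pow_of_le_one (by positivity) (by linarith) hn
  calc hypVolume n (hypSpindle γ r a)
      ≤ ∑' i : ℕ, hypVolume n (hypClosedBall (γ (Real.log (1 + r * i))) (5 * r / (1 + r * i)) ∪
          hypClosedBall (γ (-Real.log (1 + r * i))) (5 * r / (1 + r * i))) :=
        (measure_mono (hγ.hypSpindle_subset_iUnion hr (by linarith) a)).trans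
          (measure_iUnion_le _)
    _ ≤ ∑' i : ℕ, ENNReal.ofReal (2 * 80 ^ n * b i) * ω := by
        refine ENNReal.tsum_le_tsum fun i => ?_
        grw [measure_union_le, hball, hball, ← add_mul,
          ← ENNReal.ofReal_add (by positivity) (by positivity), ← two_mul, mul_assoc]
    _ = ENNReal.ofReal (2 * 80 ^ n * ∑' i : ℕ, b i) * ω := by
        rw [ENNReal.tsum_mul_right, ← tsum_mul_left,
          ENNReal.ofReal_tsum_of_nonneg (fun _ => by positivity) (hsummable.mul_left _)]
    _ ≤ ENNReal.ofReal (2 * 80 ^ n * (r ^ 2 + r)) * ω := by gcongr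

theorem IsHypLine.tendsto_hypVolume_hypSpindle {γ : ℝ → HypSpace n} (hγ : IsHypLine γ)
    (hn : 2 ≤ n) (g : ℝ → ℝ) :
    Tendsto (fun r => hypVolume n (hypSpindle γ r (g r))) (𝓝[>] 0) (𝓝 0) := by
  have hbound : Tendsto (fun r : ℝ => ENNReal.ofReal (2 * 80 ^ n * (r ^ 2 + r)) *
      volume (Metric.ball (0 : EuclideanSpace ℝ (Fin n)) 1)) (𝓝[>] 0) (𝓝 0) := by
    have hcont : Continuous fun r : ℝ => ENNReal.ofReal (2 * 80 ^ n * (r ^ 2 + r)) :=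
      ENNReal.continuous_ofReal.comp (by fun_prop)
    have h := ENNReal.Tendsto.mul_const (hcont.tendsto 0)
      (Or.inr (measure_ball_lt_top (μ := volume) (x := (0 : EuclideanSpace ℝ (Fin n)))
        (r := 1)).ne)
    simpa using h.mono_left nhdsWithin_le_nhds
  refine tendsto_of_tendsto_of_tendsto_of_le_of_le' tendsto_const_nhds hbound
    (Eventually.of_forall fun _ => zero_le) ?_
  filter_upwards [Ioo_mem_nhdsGT (show (0 : ℝ) < 1 / 5 by norm_num)] with r hr
  exact hγ.hypVolume_hypSpindle_le hn hr.1 hr.2.le _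

end Volume

theorem IsHypLine.tendsto_minLassakWidth_hypSpindle {n : ℕ} {γ : ℝ → HypSpace n}
    (hγ : IsHypLine γ) :
    Tendsto (fun r => minLassakWidth (hypSpindle γ r (spindleLength r))) (𝓝[>] 0) atTop := by
  refine tendsto_atTop_mono' _ ?_ (tendsto_inv_nhdsGT_zero (𝕜 := ℝ))
  filter_upwards [self_mem_nhdsWithin] with r hr
  exact inv_eq_one_div r ▸ hγ.one_div_le_minLassakWidth_hypSpindle hr

theorem sInf_hypVolume_eq_zero {n : ℕ} (hn : 2 ≤ n) (w : ℝ) :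
    sInf {v : ℝ≥0∞ | ∃ K : Set (HypSpace n),
      IsHypConvexBody K ∧ w ≤ minLassakWidth K ∧ v = hypVolume n K} = 0 := by
  obtain ⟨γ, hγ⟩ := exists_isHypLine (two_pos.trans_le hn)
  refine le_antisymm (ge_of_tendsto (hγ.tendsto_hypVolume_hypSpindle hn spindleLength) ?_) zero_le
  filter_upwards [hγ.tendsto_minLassakWidth_hypSpindle.eventually_ge_atTop w,
    self_mem_nhdsWithin] with r hw hr
  exact sInf_le ⟨_, isHypConvexBody_hypSpindle γ hr _, hw, rfl⟩

theorem theorem1p2_general :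
    (∀ n : ℕ, 2 ≤ n → ∀ w : ℝ,
      sInf {v : ℝ≥0∞ | ∃ K : Set (HypSpace n),
        IsHypConvexBody K ∧ w ≤ minLassakWidth K ∧ v = hypVolume n K} = 0) ∧
    (∃ g : ℝ → ℝ, (∀ r, 0 < r → 1 < g r) ∧
      ∀ (n : ℕ) (γ : ℝ → HypSpace n), IsHypLine γ →
        (∀ r, 0 < r →
          IsHypConvexBody (hypSpindle γ r (g r)) ∧
          1 / r ≤ minLassakWidth (hypSpindle γ r (g r))) ∧
        Tendsto (fun r => minLassakWidth (hypSpindle γ r (g r))) (𝓝[>] 0) atTop ∧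
        (2 ≤ n → Tendsto (fun r => hypVolume n (hypSpindle γ r (g r))) (𝓝[>] 0) (𝓝 0))) :=
  ⟨fun _ hn w => sInf_hypVolume_eq_zero hn w, spindleLength, fun _ hr => one_lt_spindleLength hr,
    fun _ γ hγ => ⟨fun _ hr =>
      ⟨isHypConvexBody_hypSpindle γ hr _, hγ.one_div_le_minLassakWidth_hypSpindle hr⟩,
      hγ.tendsto_minLassakWidth_hypSpindle, fun hn => hγ.tendsto_hypVolume_hypSpindle hn _⟩⟩

theorem theorem1p2 :
    (∀ n : ℕ, 2 ≤ n → ∀ w : ℝ, 0 < w →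
      sInf {v : ℝ≥0∞ | ∃ K : Set (HypSpace n),
        IsHypConvexBody K ∧ w ≤ minLassakWidth K ∧ v = hypVolume n K} = 0) ∧
    (∃ g : ℝ → ℝ, (∀ r ∈ Ioo (0 : ℝ) (1 / 2), 1 < g r) ∧
      ∀ n : ℕ, 2 ≤ n → ∀ γ : ℝ → HypSpace n, IsHypLine γ →
        (∀ r ∈ Ioo (0 : ℝ) (1 / 2),
          IsHypConvexBody (hypSpindle γ r (g r)) ∧
          1 / r ≤ minLassakWidth (hypSpindle γ r (g r))) ∧
        Tendsto (fun r => minLassakWidth (hypSpindle γ r (g r))) (𝓝[>] 0) atTop ∧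
        Tendsto (fun r => hypVolume n (hypSpindle γ r (g r))) (𝓝[>] 0) (𝓝 0)) :=
  have ⟨hinf, g, hg, hspindle⟩ := theorem1p2_general
  ⟨fun n hn w _ => hinf n hn w, g, fun r hr => hg r hr.1, fun n hn γ hγ =>
    have ⟨hbody, hwidth, hvolume⟩ := hspindle n γ hγ
    ⟨fun r hr => hbody r hr.1, hwidth, hvolume hn⟩⟩
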